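/- **Setting.** Let $m\ge 1$, let $M$ be a Hausdorff space (for example a compact $m$-manifold), let $\mathcal N=\{1,\dots,n\}$, and let $\iota:\mathcal N\to M$ be injective (the sample points). For each $i\in\mathcal N$ let $\varphi_i:W_i\to U_i$ be a homeomorphism from an open set $W_i\subseteq M$ containing $\iota(i)$ onto an open set $U_i\subseteq\mathbb R^m$, and let $\epsilon_i>0$. Put $\mathcal N_i=\{j:\iota(j)\in W_i\}$; for $j\in\mathcal N_i$ the point $p_j=\varphi_i(\iota(j))$ is considered in the patch $U_i$. Let $d_i$ and $B_i$ denote the Euclidean metric and open balls in $U_i$, and let $\varphi_{ij}=\varphi_j\circ\varphi_i^{-1}:U_{ij}=\varphi_i(W_i\cap W_j)\to U_{ji}$. A set $P\subset\mathbb R^m$ is a $(\mu,\epsilon)$-net for $D$ if distinct points of $P$ are at distance at least $\mu\epsilon$ and every $x\in D$ is at distance less than $\epsilon$ from $P$. **Input assumptions** (with parameters $\mu_0,\epsilon_0,\xi_0$). For every $i$: (1) $B_i(p_i,8\epsilon_i)\subseteq U_i$, and $\{p_j: j\in\mathcal N_i\}\subset U_i$ is a $(\mu_0,\epsilon_i)$-net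 for $B_i(p_i,8\epsilon_i)$; $|\epsilon_i-\epsilon_j|\le\epsilon_0\min\{\epsilon_i,\epsilon_j\}$ whenever $p_j\in B_i(p_i,8\epsilon_i)$. (2) If $p_j\in B_i(p_i,6\epsilon_i)$, then $B_i(p_i,6\epsilon_i)\cap B_i(p_j,9\epsilon_i)\subseteq U_{ij}$; and for all $j$ and all $x,y\in U_{ij}$, $|d_i(x,y)-d_j(\varphi_{ij}(x),\varphi_{ij}(y))|\le\xi_0\,d_i(x,y)$. **Parameter constraints.** $0<\mu_0\le 1$, $\epsilon_0,\xi_0\ge 0$, $\rho_0>0$, and with $\tilde\rho_0=(1+\epsilon_0)(1+\xi_0)\rho_0$ and $C=m^{3/2}(2/\mu_0)^{4m^2+5m+21}$, $$\epsilon_0\le\frac{1-\xi_0}{1+\xi_0},\qquad \tilde\rho_0\le\frac{\mu_0}{4},\qquad \xi_0\le\frac1{2^4}\Big(\frac{\rho_0}{C}\Big)^{4m+2}.$$ **Simplices.** A $j$-simplex is a set of $j+1$ points of $\mathbb R^m$. Its thickness is $1$ if $j=0$, and otherwise its smallest altitude (distance of a vertex to the affine hull of the opposite facet) divided by $j$ times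 its longest edge length. It is $\Gamma$-good if each of its $k$-dimensional faces, for every $k$, has thickness at least $\Gamma^k$, and a $\Gamma$-flake if it is not $\Gamma$-good but all its facets are. A circumscribing ball has all vertices on its boundary; the circumcentre and circumradius are those of the smallest one, whose boundary is the diametric sphere; the circumsphere is the intersection of the diametric sphere with the affine hull. **Extended algorithm.** Let $\Gamma_0=\rho_0/C$ and $\tilde\alpha_0=2^{16}m^{3/2}\Gamma_0/\mu_0^3$. All points start at $\iota(1),\dots,\iota(n)$ and the labels $i=1,\dots,n$ are processed in turn. For label $i$, points $x$ are drawn independently and uniformly from the closed ball of radius $\rho_0\epsilon_i$ about $p_i$ in $U_i$, until $x$ is a good perturbation; then the $i$-th point is moved to $\varphi_i^{-1}(x)$ and the next label is processed. Here $x$ is a good perturbation if it is not within $2\tilde\alpha_0\epsilon_i$ of the diametric sphere of any $m$-simplex whose vertices are the current images under $\varphi_i$ of points with labels $l\in\mathcal N_i\setminus\{i\}$ that initially satisfy $p_l\in B_i(p_i,(5+\tfrac32\mu_0)\epsilon_i)$. The algorithm terminates when all labels have been processed. Let $\mathsf P'\subset M$ be the resulting points, and $\mathsf Q'_i=\varphi_i(W_i\cap\mathsf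 P')\cap B_i(p_i,6\epsilon_i)$. **Lemma (Algorithm guarantee).** Under the input assumptions and the parameter constraints, the extended algorithm terminates with probability one. Whenever it has terminated, for every $i\in\mathcal N$, with $$\mu_0'=\frac{\mu_0-2\tilde\rho_0}{1+\tilde\rho_0},\qquad \epsilon_i'=(1+\tilde\rho_0)\epsilon_i,\qquad \delta=\Gamma_0^{m+1}\mu_0'\epsilon_i',$$ the set $\mathsf Q'_i$ is a $(\mu_0',\epsilon_i')$-net for the closed ball of radius $6\epsilon_i-\epsilon'_i$ about $p_i$, and it contains no forbidden configuration: there is no $(k+1)$-simplex $\tau\subseteq\mathsf Q'_i$ with $k\le m$ that is a $\Gamma_0$-flake and has a vertex $p$ whose opposite facet has a circumscribing ball with centre $c$ and radius $R<\epsilon'_i$ such that $|\,|p-c|-R\,|\le\delta$. Moreover there is no $(k+1)$-simplex $\tau\subseteq\mathsf Q'_i$, $0\le k\le m$, satisfying all of the following, with $\delta_0=\Gamma_0^{m+1}$: each vertex is within $\frac{2^{13}\Gamma_0}{\mu_0^3}R$ of the circumsphere of its opposite facet, where $R$ is the circumradius of that facet; every facet has circumradius less than $2\epsilon_i$; the longest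 edge of $\tau$ is shorter than $\frac52(1+\frac12\delta_0\mu_0)\epsilon_i$; every facet is $\Gamma_0$-good. -/

import Mathlib

noncomputable section

namespace ManifoldMesh

open MeasureTheory

/-- The model space `ℝᵐ` with its Euclidean metric. -/
abbrev E (m : ℕ) := EuclideanSpace ℝ (Fin m)

/-! ### Nets and simplices in Euclidean space

A simplex is the finite set of its vertices; a `j`-simplex has `j + 1` vertices. -/

section Euclidean

variable {m : ℕ}

/-- `P` is a `(μ, ε)`-net for `D`: it is `μ ε`-separated and `ε`-dense for `D`. -/
structure IsNet (μ ε : ℝ) (P D : Set (E m)) : Prop where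
  separated : ∀ p ∈ P, ∀ q ∈ P, p ≠ q → μ * ε ≤ dist p q
  dense : ∀ x ∈ D, ∃ p ∈ P, dist x p < ε

/-- The altitude of the vertex `p` in `σ`: its distance to the affine hull of the opposite facet. -/
def altitude (σ : Finset (E m)) (p : E m) : ℝ :=
  Metric.infDist p (affineSpan ℝ ((σ : Set (E m)) \ {p}) : Set (E m))

/-- The thickness of a `j`-simplex: `1` if `j = 0`, and otherwise the smallest altitude divided
by `j` times the longest edge length. -/
def thickness (σ : Finset (E m)) : ℝ :=
  if σ.card ≤ 1 then 1
  else (⨅ p : σ, altitude σ (p : E m)) / (((σ.card - 1 : ℕ) : ℝ) * Metric.diam (σ : Set (E m)))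

/-- `σ` is `Γ`-good: each of its `j`-dimensional faces has thickness at least `Γ ^ j`. -/
def IsGood (Γ : ℝ) (σ : Finset (E m)) : Prop :=
  ∀ s ⊆ σ, s.Nonempty → Γ ^ (s.card - 1) ≤ thickness s

open Classical in
/-- The facet of `τ` opposite to the vertex `p`. -/
def oppFacet (τ : Finset (E m)) (p : E m) : Finset (E m) := τ.erase p

/-- A `Γ`-flake is not `Γ`-good, but all of its facets are. -/
def IsFlake (Γ : ℝ) (τ : Finset (E m)) : Prop :=
  ¬ IsGood Γ τ ∧ ∀ p ∈ τ, IsGood Γ (oppFacet τ p)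

/-- The ball with centre `c` and radius `R` is a circumscribing ball of `σ`. -/
def IsCircumscribing (σ : Finset (E m)) (c : E m) (R : ℝ) : Prop :=
  ∀ v ∈ σ, dist v c = R

/-- `c` is the circumcentre and `R` the circumradius of `σ`: they are the centre and the radius
of the smallest circumscribing ball. -/
def IsCircumcentre (σ : Finset (E m)) (c : E m) (R : ℝ) : Prop :=
  IsCircumscribing σ c R ∧ ∀ c' R', IsCircumscribing σ c' R' → R ≤ R'

/-- Forbidden configuration, with flake parameter `Γ`, protection `δ` and sampling radius `ε'`:
a `(k + 1)`-simplex with `k ≤ m` that is a `Γ`-flake and has a vertex `p` whose opposite facet has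
a circumscribing ball of radius `R < ε'`, with `p` within `δ` of the boundary of that ball. -/
def IsForbidden (Γ δ ε' : ℝ) (τ : Finset (E m)) : Prop :=
  ∃ k ≤ m, τ.card = k + 2 ∧ IsFlake Γ τ ∧
    ∃ p ∈ τ, ∃ (c : E m) (R : ℝ),
      IsCircumscribing (oppFacet τ p) c R ∧ R < ε' ∧ |dist p c - R| ≤ δ

/-- The `α`-hoop property: each vertex `p` of `τ` is within `α R` of the circumsphere (the
diametric sphere intersected with the affine hull) of its opposite facet, where `R` is the
circumradius of that facet. -/
def HasHoopProperty (α : ℝ) (τ : Finset (E m)) : Prop :=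
  ∀ p ∈ τ, ∃ (c : E m) (R : ℝ), IsCircumcentre (oppFacet τ p) c R ∧
    Metric.infDist p
      (Metric.sphere c R ∩ (affineSpan ℝ (oppFacet τ p : Set (E m)) : Set (E m))) ≤ α * R

/-- The four properties of forbidden configurations, in terms of the parameters of the initial
point set: hoop property, facet circumradii, diameter, and good facets. -/
def HasForbiddenProperties (μ₀ ε Γ δ₀ : ℝ) (τ : Finset (E m)) : Prop :=
  ∃ k ≤ m, τ.card = k + 2 ∧
    HasHoopProperty (2 ^ 13 * Γ / μ₀ ^ 3) τ ∧
    (∀ p ∈ τ, ∃ (c : E m) (R : ℝ), IsCircumcentre (oppFacet τ p) c R ∧ R < 2 * ε) ∧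
    Metric.diam (τ : Set (E m)) < 5 / 2 * (1 + 1 / 2 * δ₀ * μ₀) * ε ∧
    ∀ p ∈ τ, IsGood Γ (oppFacet τ p)

end Euclidean

/-! ### Input data -/

/-- Sample points `pt i`, `i = 1, …, n`, in a space `M`, each with a coordinate chart `φᵢ` of `M`
whose domain `Wᵢ` contains `pt i`, and with a sampling radius `εᵢ`. -/
structure Input (m n : ℕ) (M : Type*) [TopologicalSpace M] where
  pt : Fin n → M
  pt_injective : Function.Injective pt
  chart : Fin n → OpenPartialHomeomorph M (E m)
  pt_mem : ∀ i, pt i ∈ (chart i).source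
  radius : Fin n → ℝ
  radius_pos : ∀ i, 0 < radius i

namespace Input

variable {m n : ℕ} {M : Type*} [TopologicalSpace M] (D : Input m n M)

/-- The coordinate patch `Uᵢ = φᵢ(Wᵢ)`. -/
def patch (i : Fin n) : Set (E m) := (D.chart i).target

/-- The set of neighbours `Nᵢ`: the labels of the sample points in `Wᵢ`. -/
def nbrs (i : Fin n) : Set (Fin n) := {j | D.pt j ∈ (D.chart i).source}

/-- The point `p_j` in the coordinate patch `Uᵢ` (meaningful for `j ∈ Nᵢ`). -/
def coord (i j : Fin n) : E m := D.chart i (D.pt j)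

/-- The centre `pᵢ` in its own coordinate patch `Uᵢ`. -/
def centre (i : Fin n) : E m := D.coord i i

/-- The transition function `φᵢⱼ = φⱼ ∘ φᵢ⁻¹`; its domain `Uᵢⱼ = φᵢ(Wᵢ ∩ Wⱼ)` is its `source`. -/
def transition (i j : Fin n) : OpenPartialHomeomorph (E m) (E m) :=
  (D.chart i).symm.trans (D.chart j)

/-- The input assumptions, with separation parameter `μ₀`, sampling variation parameter `ε₀` and
metric distortion parameter `ξ₀`. -/
structure InputAssumptions (μ₀ ε₀ ξ₀ : ℝ) : Prop where
  ball_subset : ∀ i, Metric.ball (D.centre i) (8 * D.radius i) ⊆ D.patch i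
  net : ∀ i, IsNet μ₀ (D.radius i) (D.coord i '' D.nbrs i)
    (Metric.ball (D.centre i) (8 * D.radius i))
  adaptive : ∀ i, ∀ j ∈ D.nbrs i, dist (D.coord i j) (D.centre i) < 8 * D.radius i →
    |D.radius i - D.radius j| ≤ ε₀ * min (D.radius i) (D.radius j)
  domain_large : ∀ i, ∀ j ∈ D.nbrs i, dist (D.coord i j) (D.centre i) < 6 * D.radius i →
    Metric.ball (D.centre i) (6 * D.radius i) ∩ Metric.ball (D.coord i j) (9 * D.radius i) ⊆
      (D.transition i j).source
  distortion : ∀ i j, ∀ x ∈ (D.transition i j).source, ∀ y ∈ (D.transition i j).source,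
    |dist x y - dist (D.transition i j x) (D.transition i j y)| ≤ ξ₀ * dist x y

end Input

/-! ### Parameters -/

/-- `ρ̃₀ = (1 + ε₀) (1 + ξ₀) ρ₀`. -/
def tildeRho (ε₀ ξ₀ ρ₀ : ℝ) : ℝ := (1 + ε₀) * (1 + ξ₀) * ρ₀

/-- `C = m^{3/2} (2 / μ₀)^{4m² + 5m + 21}`. -/
def paramC (m : ℕ) (μ₀ : ℝ) : ℝ :=
  (m : ℝ) ^ (3 / 2 : ℝ) * (2 / μ₀) ^ (4 * m ^ 2 + 5 * m + 21)

/-- `Γ₀ = ρ₀ / C`. -/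
def gammaZero (m : ℕ) (μ₀ ρ₀ : ℝ) : ℝ := ρ₀ / paramC m μ₀

/-- `α̃₀ = 2¹⁶ m^{3/2} Γ₀ / μ₀³`. -/
def tildeAlpha (m : ℕ) (μ₀ ρ₀ : ℝ) : ℝ :=
  2 ^ 16 * (m : ℝ) ^ (3 / 2 : ℝ) * gammaZero m μ₀ ρ₀ / μ₀ ^ 3

/-- The parameter constraints, together with the standing ranges of the parameters. -/
structure ParameterConstraints (m : ℕ) (μ₀ ε₀ ξ₀ ρ₀ : ℝ) : Prop where
  dim_pos : 1 ≤ m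
  mu_pos : 0 < μ₀
  mu_le_one : μ₀ ≤ 1
  eps_nonneg : 0 ≤ ε₀
  xi_nonneg : 0 ≤ ξ₀
  rho_pos : 0 < ρ₀
  eps_le : ε₀ ≤ (1 - ξ₀) / (1 + ξ₀)
  rho_le : tildeRho ε₀ ξ₀ ρ₀ ≤ μ₀ / 4
  xi_le : ξ₀ ≤ 1 / 2 ^ 4 * (ρ₀ / paramC m μ₀) ^ (4 * m + 2)

/-! ### The extended algorithm -/

namespace Input

variable {m n : ℕ} {M : Type*} [TopologicalSpace M] (D : Input m n M)

/-- The current point set `P'ᵢ = φᵢ(Wᵢ ∩ P')` in the `i`-th patch, when the current (partly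
perturbed) position in `M` of the point with label `l` is `q l`. -/
def current (q : Fin n → M) (i : Fin n) : Set (E m) :=
  D.chart i '' (Set.range q ∩ (D.chart i).source)

/-- The region of interest `Q'ᵢ = P'ᵢ ∩ B(pᵢ, 6 εᵢ)`. -/
def region (q : Fin n → M) (i : Fin n) : Set (E m) :=
  D.current q i ∩ Metric.ball (D.centre i) (6 * D.radius i)

/-- `Sᵢ`: the abstract `m`-simplices on the labels other than `i` whose initial positions in `Uᵢ`
lie in the ball of radius `(5 + 3 μ₀ / 2) εᵢ` around `pᵢ`. -/
def nearSimplices (μ₀ : ℝ) (i : Fin n) : Set (Finset (Fin n)) :=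
  {s | s.card = m + 1 ∧ ∀ l ∈ s, l ≠ i ∧ l ∈ D.nbrs i ∧
    D.coord i l ∈ Metric.ball (D.centre i) ((5 + 3 * μ₀ / 2) * D.radius i)}

open Classical in
/-- `pᵢ ↦ x` is a good perturbation: `x` is not within `2 α̃₀ εᵢ` of the diametric sphere of any
simplex of `Sᵢ` in its current position. -/
def IsGoodPerturbation (μ₀ ρ₀ : ℝ) (q : Fin n → M) (i : Fin n) (x : E m) : Prop :=
  ¬ ∃ s ∈ D.nearSimplices μ₀ i, ∃ (c : E m) (R : ℝ),
    IsCircumcentre (s.image fun l => D.chart i (q l)) c R ∧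
      Metric.infDist x (Metric.sphere c R) ≤ 2 * tildeAlpha m μ₀ ρ₀ * D.radius i

open Classical in
/-- One trial of the algorithm. A state `(i, q)` consists of the label `i` that is being processed
and the current positions `q` of all points. The trial `u` (a point of the closed unit ball)
proposes `x = pᵢ + ρ₀ εᵢ u`. If this is a good perturbation, the point with label `i` is moved
to `φᵢ⁻¹(x)` and the next label is processed; otherwise nothing changes. -/
def step (μ₀ ρ₀ : ℝ) (u : E m) (s : ℕ × (Fin n → M)) : ℕ × (Fin n → M) :=
  if h : s.1 < n then
    let i : Fin n := ⟨s.1, h⟩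
    let x : E m := D.centre i + (ρ₀ * D.radius i) • u
    if D.IsGoodPerturbation μ₀ ρ₀ s.2 i x then
      (s.1 + 1, Function.update s.2 i ((D.chart i).symm x))
    else s
  else s

/-- The state after `t` trials, when the successive trials are `ω 0, ω 1, …`. -/
def run (μ₀ ρ₀ : ℝ) (ω : ℕ → E m) : ℕ → ℕ × (Fin n → M)
  | 0 => (0, D.pt)
  | t + 1 => D.step μ₀ ρ₀ (ω t) (run μ₀ ρ₀ ω t)

/-- The algorithm has terminated after `t` trials: all labels have been processed. -/
def TerminatedAt (μ₀ ρ₀ : ℝ) (ω : ℕ → E m) (t : ℕ) : Prop :=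
  (D.run μ₀ ρ₀ ω t).1 = n

/-- The positions in `M` of the points after `t` trials. -/
def output (μ₀ ρ₀ : ℝ) (ω : ℕ → E m) (t : ℕ) : Fin n → M :=
  (D.run μ₀ ρ₀ ω t).2

end Input

/-- The uniform probability distribution on the closed unit ball of `ℝᵐ`. -/
def uniformBall (m : ℕ) : Measure (E m) :=
  ProbabilityTheory.cond volume (Metric.closedBall (0 : E m) 1)

instance (m : ℕ) : IsProbabilityMeasure (uniformBall m) :=
  ProbabilityTheory.cond_isProbabilityMeasure_of_finite
    (Metric.measure_closedBall_pos volume (0 : E m) one_pos).ne'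
    measure_closedBall_lt_top.ne

/-- The law of a sequence of independent uniform trials. -/
def trialLaw (m : ℕ) : Measure (ℕ → E m) := Measure.infinitePi fun _ => uniformBall m

end ManifoldMesh

end

/-!
Termination is a volume estimate. When a label `i` is processed, a trial fails only if it falls into
one of boundedly many thin spherical shells (`ncard_nearSimplices_le`, by packing), each of
which fills only a small fraction of the ball of trials (`volumeReal_shell_le`); by the choice of
the constant `C` the shells do not fill the ball. Being a good perturbation is an open condition, so
in every state the successful trials contain a member of a countable basis that meets the unit
ball. Almost surely all these basis sets are visited infinitely often, hence no run gets stuck.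

For the output, `IsPerturbation.mem_source` and `IsPerturbation.mem_nbrs` compare perturbed and
initial positions in every patch: they differ by at most `ρ̃₀ εᵢ` in the patch of `i`. This gives
the net property. The transition from one chart domain to another is a connectedness argument
that uses that `M` is a Hausdorff space (`InputAssumptions.mem_source`).

Both kinds of forbidden simplices are reduced to one notion, `IsNearlyCospherical`: each vertex is
close to a point of the affine hull of the opposite facet that has small power with respect to the
circumsphere of that facet. For a flake this holds because one tiny altitude forces all altitudes to
be small (`altitude_le_of_altitude_lt`), and because the power of an affine combination depends
linearly on the powers of the vertices (`abs_inertia_oppFacet_le`). The notion is expressed by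
barycentric coordinates and mutual distances only. The coordinates are bounded, since the facets
are good, so the notion survives the passage to another patch with small distortion: the vertex
remains close to every sphere through the vertices of the opposite facet
(`IsNearlyCospherical.abs_dist_sub_radius_le`).

Suppose that the output contained such a simplex, and consider its vertex `j` that was processed
last. In the patch of `j` the other vertices were already in their final positions and, being
affinely independent and near `pⱼ`, they can be completed to a nondegenerate `m`-simplex of `Sⱼ`.
Its diametric sphere passes through them, hence within `2 α̃₀ εⱼ` of the new position of `j`,
which contradicts the choice of that position (`not_isNearlyCospherical`).
-/

namespace ManifoldMesh

open MeasureTheory Metric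

/-! ### Affine weights and powers of points -/

section Inertia

variable {ι V V' : Type*} [PseudoMetricSpace V] [PseudoMetricSpace V']

/-- Half the weighted sum of the squared distances between the points `f v`, `v ∈ s`. When the
weights sum to one, this is minus the power of the point `∑ w v • f v` with respect to every sphere
through all the points `f v`; it depends on the points only through their mutual distances. -/
noncomputable def inertia (s : Finset ι) (w : ι → ℝ) (f : ι → V) : ℝ :=
  1 / 2 * ∑ v ∈ s, ∑ u ∈ s, w v * w u * dist (f v) (f u) ^ 2

theorem abs_inertia_sub_le {s : Finset ι} (w : ι → ℝ) {f : ι → V} {g : ι → V'} {η : ℝ}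
    (h : ∀ v ∈ s, ∀ u ∈ s, |dist (f v) (f u) ^ 2 - dist (g v) (g u) ^ 2| ≤ η) :
    |inertia s w f - inertia s w g| ≤ 1 / 2 * (∑ v ∈ s, |w v|) ^ 2 * η := by
  have : inertia s w f - inertia s w g = 1 / 2 * ∑ v ∈ s, ∑ u ∈ s,
      w v * w u * (dist (f v) (f u) ^ 2 - dist (g v) (g u) ^ 2) := by
    simp_rw [inertia, mul_sub, Finset.sum_sub_distrib]
    ring
  rw [this, abs_mul, abs_of_pos (by norm_num : (0 : ℝ) < 1 / 2), mul_assoc]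
  refine mul_le_mul_of_nonneg_left ?_ (by norm_num)
  rw [sq, Finset.sum_mul_sum, Finset.sum_mul]
  refine (Finset.abs_sum_le_sum_abs _ _).trans (Finset.sum_le_sum fun v hv => ?_)
  rw [Finset.sum_mul]
  refine (Finset.abs_sum_le_sum_abs _ _).trans (Finset.sum_le_sum fun u hu => ?_)
  rw [abs_mul, abs_mul]
  exact mul_le_mul_of_nonneg_left (h v hv u hu) (by positivity)

end Inertia

section Weights

variable {ι V : Type*} [NormedAddCommGroup V] [InnerProductSpace ℝ V]

/-- The identity behind all computations with weights: the norm of a weighted sum of vectors in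
terms of their lengths and mutual distances. -/
theorem norm_sum_smul_sub_sq (s : Finset ι) (w : ι → ℝ) (f : ι → V) (x : V) :
    ‖∑ v ∈ s, w v • (f v - x)‖ ^ 2 =
      (∑ v ∈ s, w v) * (∑ v ∈ s, w v * dist (f v) x ^ 2) - inertia s w f := by
  have key : ∀ v u, w v * w u * inner ℝ (f v - x) (f u - x) =
      1 / 2 * (w u * (w v * dist (f v) x ^ 2)) + 1 / 2 * (w v * (w u * dist (f u) x ^ 2))
        - 1 / 2 * (w v * w u * dist (f v) (f u) ^ 2) := by
    intro v u
    have h := norm_sub_sq_real (f v - x) (f u - x)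
    rw [sub_sub_sub_cancel_right] at h
    rw [dist_eq_norm, dist_eq_norm, dist_eq_norm, h]
    ring
  rw [← real_inner_self_eq_norm_sq, sum_inner]
  simp_rw [inner_sum, real_inner_smul_left, real_inner_smul_right, ← mul_assoc, key]
  simp_rw [Finset.sum_sub_distrib, Finset.sum_add_distrib, ← Finset.mul_sum, ← Finset.sum_mul]
  rw [inertia, ← Finset.mul_sum]
  ring

theorem sum_smul_sub_eq {s : Finset ι} {w : ι → ℝ} (hw : ∑ v ∈ s, w v = 1) (f : ι → V) (x : V) :
    ∑ v ∈ s, w v • (f v - x) = (∑ v ∈ s, w v • f v) - x := by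
  simp_rw [smul_sub, Finset.sum_sub_distrib, ← Finset.sum_smul, hw, one_smul]

theorem dist_sum_smul_sq {s : Finset ι} {w : ι → ℝ} (hw : ∑ v ∈ s, w v = 1) (f : ι → V) (x : V) :
    dist (∑ v ∈ s, w v • f v) x ^ 2 = ∑ v ∈ s, w v * dist (f v) x ^ 2 - inertia s w f := by
  rw [dist_eq_norm, ← sum_smul_sub_eq hw, norm_sum_smul_sub_sq, hw, one_mul]

theorem norm_sum_smul_sq {s : Finset ι} {w : ι → ℝ} (hw : ∑ v ∈ s, w v = 0) (f : ι → V) :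
    ‖∑ v ∈ s, w v • f v‖ ^ 2 = - inertia s w f := by
  have h := norm_sum_smul_sub_sq s w f 0
  simpa [hw] using h

/-- The power of an affine combination of points of a sphere with respect to that sphere. -/
theorem dist_sum_smul_sq_of_dist_eq {s : Finset ι} {w : ι → ℝ} (hw : ∑ v ∈ s, w v = 1)
    {f : ι → V} {c : V} {R : ℝ} (hc : ∀ v ∈ s, dist (f v) c = R) :
    dist (∑ v ∈ s, w v • f v) c ^ 2 = R ^ 2 - inertia s w f := by
  rw [dist_sum_smul_sq hw, Finset.sum_congr rfl fun v hv => by rw [hc v hv], ← Finset.sum_mul, hw,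
    one_mul]

/-- If squared distances change by at most `η` under a map, the squared distance of a point to an
affine combination changes by at most `η` times a quadratic expression in the weights. -/
theorem dist_sum_smul_sq_le {V' : Type*} [NormedAddCommGroup V'] [InnerProductSpace ℝ V']
    {s : Finset ι} {w : ι → ℝ} (hw : ∑ v ∈ s, w v = 1) {f : ι → V} {g : ι → V'} {x : V} {y : V'}
    {η : ℝ} (hη : 0 ≤ η)
    (hx : ∀ v ∈ s, |dist (f v) x ^ 2 - dist (g v) y ^ 2| ≤ η)
    (h : ∀ v ∈ s, ∀ u ∈ s, |dist (f v) (f u) ^ 2 - dist (g v) (g u) ^ 2| ≤ η) :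
    dist (∑ v ∈ s, w v • g v) y ^ 2 ≤
      dist (∑ v ∈ s, w v • f v) x ^ 2 + 3 / 2 * (∑ v ∈ s, |w v|) ^ 2 * η := by
  have h1 := abs_le.1 (abs_inertia_sub_le w h)
  have h2 : |∑ v ∈ s, w v * dist (f v) x ^ 2 - ∑ v ∈ s, w v * dist (g v) y ^ 2| ≤
      (∑ v ∈ s, |w v|) * η := by
    rw [← Finset.sum_sub_distrib, Finset.sum_mul]
    refine (Finset.abs_sum_le_sum_abs _ _).trans (Finset.sum_le_sum fun v hv => ?_)
    rw [← mul_sub, abs_mul]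
    exact mul_le_mul_of_nonneg_left (hx v hv) (abs_nonneg _)
  have h3 : 1 ≤ ∑ v ∈ s, |w v| := by
    rw [← hw]
    exact Finset.sum_le_sum fun v _ => le_abs_self _
  have h4 : (∑ v ∈ s, |w v|) * η ≤ (∑ v ∈ s, |w v|) ^ 2 * η := by
    gcongr
    nlinarith
  rw [dist_sum_smul_sq hw, dist_sum_smul_sq hw]
  have := (abs_le.1 h2).1
  linarith [h1.1]

end Weights

section AffineSpan

variable {ι V : Type*} [NormedAddCommGroup V] [InnerProductSpace ℝ V]

theorem sum_smul_mem_affineSpan_image {s : Finset ι} {w : ι → ℝ} (hw : ∑ v ∈ s, w v = 1)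
    (f : ι → V) : ∑ v ∈ s, w v • f v ∈ affineSpan ℝ (f '' s) := by
  have h := affineCombination_mem_affineSpan (k := ℝ) (s := s.attach) (w := fun v => w v)
    (by rw [Finset.sum_attach s w]; exact hw) (fun v : s => f v)
  rw [Finset.affineCombination_eq_linear_combination _ _ _
    (by rw [Finset.sum_attach s w]; exact hw)] at h
  rw [Finset.sum_attach s fun v => w v • f v] at h
  convert h
  ext x
  simp

theorem sum_smul_mem_affineSpan {s : Finset V} {w : V → ℝ} (hw : ∑ v ∈ s, w v = 1) :
    ∑ v ∈ s, w v • v ∈ affineSpan ℝ (s : Set V) := by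
  simpa using sum_smul_mem_affineSpan_image hw id

theorem exists_weights_of_mem_affineSpan {s : Finset V} {x : V}
    (hx : x ∈ affineSpan ℝ (s : Set V)) :
    ∃ w : V → ℝ, ∑ v ∈ s, w v = 1 ∧ ∑ v ∈ s, w v • v = x := by
  classical
  have h : x ∈ affineSpan ℝ (Set.range fun v : s => (v : V)) := by
    convert hx
    simp
  obtain ⟨w, hw, rfl⟩ := eq_affineCombination_of_mem_affineSpan_of_fintype h
  refine ⟨fun v => if hv : v ∈ s then w ⟨v, hv⟩ else 0, ?_, ?_⟩
  · rw [← Finset.sum_coe_sort, ← hw]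
    exact Finset.sum_congr rfl fun v _ => by simp
  · rw [Finset.affineCombination_eq_linear_combination _ _ _ hw, ← Finset.sum_coe_sort]
    exact Finset.sum_congr rfl fun v _ => by simp

end AffineSpan

/-! ### Altitudes, good simplices and flakes -/

section Altitudes

variable {m : ℕ}

theorem mem_oppFacet {τ : Finset (E m)} {p v : E m} : v ∈ oppFacet τ p ↔ v ≠ p ∧ v ∈ τ := by
  classical
  exact Finset.mem_erase

theorem coe_oppFacet (τ : Finset (E m)) (p : E m) :
    (oppFacet τ p : Set (E m)) = (τ : Set (E m)) \ {p} := by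
  classical
  exact Finset.coe_erase p τ

theorem card_oppFacet {τ : Finset (E m)} {p : E m} (hp : p ∈ τ) {k : ℕ} (h : τ.card = k + 1) :
    (oppFacet τ p).card = k := by
  classical
  have := Finset.card_erase_of_mem hp
  rw [oppFacet, this, h, Nat.add_sub_cancel]

theorem add_sum_oppFacet {A : Type*} [AddCommMonoid A] {τ : Finset (E m)} {p : E m} (hp : p ∈ τ)
    (f : E m → A) : f p + ∑ v ∈ oppFacet τ p, f v = ∑ v ∈ τ, f v := by
  classical
  exact Finset.add_sum_erase τ f hp

theorem altitude_nonneg (τ : Finset (E m)) (p : E m) : 0 ≤ altitude τ p :=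
  Metric.infDist_nonneg

theorem altitude_le_dist_sum_smul {τ : Finset (E m)} {p : E m} {w : E m → ℝ}
    (hw : ∑ v ∈ oppFacet τ p, w v = 1) :
    altitude τ p ≤ dist p (∑ v ∈ oppFacet τ p, w v • v) := by
  rw [altitude, ← coe_oppFacet]
  exact Metric.infDist_le_dist_of_mem (sum_smul_mem_affineSpan hw)

theorem exists_weights_dist_eq_altitude {τ : Finset (E m)} {p : E m}
    (h : (oppFacet τ p).Nonempty) :
    ∃ w : E m → ℝ, ∑ v ∈ oppFacet τ p, w v = 1 ∧
      dist p (∑ v ∈ oppFacet τ p, w v • v) = altitude τ p := by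
  obtain ⟨x, hx, hd⟩ := (AffineSubspace.closed_of_finiteDimensional
    (affineSpan ℝ (oppFacet τ p : Set (E m)))).exists_infDist_eq_dist
    (Set.Nonempty.mono (subset_affineSpan ℝ _) (Finset.coe_nonempty.2 h)) p
  obtain ⟨w, hw, rfl⟩ := exists_weights_of_mem_affineSpan hx
  refine ⟨w, hw, ?_⟩
  rw [altitude, ← coe_oppFacet, hd]

/-- The altitudes control the coefficients of a vector of the direction of the affine hull. -/
theorem abs_mul_altitude_le {τ : Finset (E m)} {w : E m → ℝ} (hw : ∑ v ∈ τ, w v = 0) {p : E m}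
    (hp : p ∈ τ) : |w p| * altitude τ p ≤ ‖∑ v ∈ τ, w v • v‖ := by
  rcases eq_or_ne (w p) 0 with h0 | h0
  · simp [h0]
  rw [← add_sum_oppFacet hp] at hw
  have h1 : ∑ v ∈ oppFacet τ p, -(w v / w p) = 1 := by
    rw [Finset.sum_neg_distrib, ← Finset.sum_div]
    field_simp
    linarith
  have h2 := altitude_le_dist_sum_smul h1
  have h3 : ∑ v ∈ τ, w v • v = w p • (p - ∑ v ∈ oppFacet τ p, -(w v / w p) • v) := by
    rw [← add_sum_oppFacet hp, smul_sub, Finset.smul_sum, sub_eq_add_neg, ← Finset.sum_neg_distrib]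
    congr 1
    refine Finset.sum_congr rfl fun v _ => ?_
    rw [neg_smul, smul_neg, neg_neg, smul_smul, mul_div_cancel₀ _ h0]
  rw [h3, norm_smul, Real.norm_eq_abs, ← dist_eq_norm]
  exact mul_le_mul_of_nonneg_left h2 (abs_nonneg _)

theorem IsGood.le_altitude {Γ : ℝ} {σ : Finset (E m)} (h : IsGood Γ σ) {k : ℕ}
    (hk : σ.card = k + 1) (hk1 : 1 ≤ k) {v : E m} (hv : v ∈ σ) :
    Γ ^ k * (k * Metric.diam (σ : Set (E m))) ≤ altitude σ v := by
  have h1 := h σ subset_rfl ⟨v, hv⟩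
  rw [thickness, if_neg (by omega), hk, Nat.add_sub_cancel] at h1
  rcases (Metric.diam_nonneg (s := (σ : Set (E m)))).eq_or_lt with h0 | h0
  · rw [← h0, mul_zero, mul_zero]
    exact altitude_nonneg _ _
  rw [le_div_iff₀ (by positivity)] at h1
  refine h1.trans ?_
  exact ciInf_le (Set.finite_range _).bddBelow (⟨v, hv⟩ : σ)

/-- In a good simplex the barycentric coordinates of a point close to the vertices are bounded. -/
theorem IsGood.abs_weight_mul_le {Γ : ℝ} (hΓ : 0 ≤ Γ) {σ : Finset (E m)} (h : IsGood Γ σ) {k : ℕ}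
    (hk : σ.card = k + 1) (hk1 : 1 ≤ k) {s r : ℝ} (hs : s ≤ Metric.diam (σ : Set (E m)))
    {w : E m → ℝ} (hw : ∑ v ∈ σ, w v = 1)
    (hD : ∀ u ∈ σ, dist (∑ v ∈ σ, w v • v) u ≤ r) {v : E m} (hv : v ∈ σ) :
    |w v| * (Γ ^ k * (k * s)) ≤ r := by
  classical
  obtain ⟨u, hu, huv⟩ := Finset.exists_mem_ne (by omega : 1 < σ.card) v
  have h1 : ∑ x ∈ σ, (w x - if x = u then 1 else 0) = 0 := by
    rw [Finset.sum_sub_distrib, hw, Finset.sum_ite_eq' σ u, if_pos hu, sub_self]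
  have h2 := abs_mul_altitude_le h1 hv
  have h3 : ∑ x ∈ σ, (w x - if x = u then (1 : ℝ) else 0) • x = (∑ x ∈ σ, w x • x) - u := by
    simp_rw [sub_smul, Finset.sum_sub_distrib, ite_smul, one_smul, zero_smul]
    rw [Finset.sum_ite_eq' σ u, if_pos hu]
  rw [h3, if_neg huv.symm, sub_zero, ← dist_eq_norm] at h2
  refine le_trans ?_ (h2.trans (hD u hu))
  refine mul_le_mul_of_nonneg_left (le_trans ?_ (h.le_altitude hk hk1 hv)) (abs_nonneg _)
  gcongr

theorem diam_pos_of_card {σ : Finset (E m)} (h : 1 < σ.card) :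
    0 < Metric.diam (σ : Set (E m)) := by
  obtain ⟨a, ha, b, hb, hab⟩ := Finset.one_lt_card.1 h
  exact (dist_pos.2 hab).trans_le (Metric.dist_le_diam_of_mem σ.finite_toSet.isBounded ha hb)

theorem le_diam_of_separated {σ : Finset (E m)} (h : 1 < σ.card) {s : ℝ}
    (hs : ∀ a ∈ σ, ∀ b ∈ σ, a ≠ b → s ≤ dist a b) : s ≤ Metric.diam (σ : Set (E m)) := by
  obtain ⟨a, ha, b, hb, hab⟩ := Finset.one_lt_card.1 h
  exact (hs a ha b hb hab).trans (Metric.dist_le_diam_of_mem σ.finite_toSet.isBounded ha hb)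

theorem IsFlake.exists_altitude_lt {Γ : ℝ} {τ : Finset (E m)} (h : IsFlake Γ τ) {k : ℕ}
    (hk : τ.card = k + 2) :
    ∃ q ∈ τ, altitude τ q < Γ ^ (k + 1) * ((k + 1) * Metric.diam (τ : Set (E m))) := by
  have h1 := h.1
  simp only [IsGood, not_forall, not_le] at h1
  obtain ⟨s, hs, hs0, hlt⟩ := h1
  have hsτ : s = τ := by
    by_contra hne
    obtain ⟨p, hp, hps⟩ := Finset.exists_of_ssubset (hs.ssubset_of_ne hne)
    refine hlt.not_ge (h.2 p hp s (fun v hv => mem_oppFacet.2 ⟨?_, hs hv⟩) hs0)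
    rintro rfl
    exact hps hv
  subst hsτ
  have hd := diam_pos_of_card (by omega : 1 < s.card)
  have : Nonempty s := hs0.to_subtype
  obtain ⟨q, hq⟩ := exists_eq_ciInf_of_finite (f := fun p : s => altitude s (p : E m))
  rw [thickness, if_neg (by omega), hk, show k + 2 - 1 = k + 1 from rfl, ← hq,
    div_lt_iff₀ (by positivity)] at hlt
  refine ⟨q, q.2, ?_⟩
  push_cast at hlt
  exact hlt

/-- If one altitude of a simplex with good facets is tiny, then all altitudes are small. -/
theorem altitude_le_of_altitude_lt {Γ s r : ℝ} (hΓ : 0 < Γ) (hs : 0 < s)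
    (hΓs : 4 * Γ * r ≤ s) {τ : Finset (E m)} {k : ℕ}
    (hk : τ.card = k + 2) (hk1 : 1 ≤ k) (hsep : ∀ a ∈ τ, ∀ b ∈ τ, a ≠ b → s ≤ dist a b)
    (hr : ∀ a ∈ τ, ∀ b ∈ τ, dist a b ≤ r)
    (hgood : ∀ p ∈ τ, IsGood Γ (oppFacet τ p)) {q : E m} (hq : q ∈ τ)
    (hqalt : altitude τ q < Γ ^ (k + 1) * ((k + 1) * Metric.diam (τ : Set (E m))))
    {p : E m} (hp : p ∈ τ) : altitude τ p ≤ 4 * Γ * r ^ 2 / s := by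
  have hsr : s ≤ r := by
    obtain ⟨a, ha, b, hb, hab⟩ := Finset.one_lt_card.1 (by omega : 1 < τ.card)
    exact (hsep a ha b hb hab).trans (hr a ha b hb)
  have hr0 : 0 < r := hs.trans_le hsr
  have hdr : Metric.diam (τ : Set (E m)) ≤ r := Metric.diam_le_of_forall_dist_le hr0.le hr
  have hk1' : (1 : ℝ) ≤ k := by exact_mod_cast hk1
  have hq1 : altitude τ q ≤ Γ ^ (k + 1) * (2 * k * r) := by
    refine hqalt.le.trans ?_
    gcongr
    linarith
  have hΓ4 : Γ ≤ 1 / 4 := by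
    have : 4 * Γ * r ≤ 1 * r := by linarith
    have := le_of_mul_le_mul_right this hr0
    linarith
  rcases eq_or_ne p q with rfl | hpq
  · refine hq1.trans ?_
    have h2 : Γ ^ k * k ≤ 1 := by
      have h4 : (k : ℝ) ≤ 2 ^ k := by exact_mod_cast Nat.lt_two_pow_self.le
      calc Γ ^ k * k ≤ (1 / 2) ^ k * 2 ^ k := by gcongr; linarith
        _ = 1 := by rw [← mul_pow]; norm_num
    rw [le_div_iff₀ hs]
    calc Γ ^ (k + 1) * (2 * k * r) * s = (Γ ^ k * k) * (2 * Γ * r * s) := by ring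
      _ ≤ 1 * (2 * Γ * r * r) := by gcongr
      _ ≤ 4 * Γ * r ^ 2 := by nlinarith [mul_pos hΓ (mul_pos hr0 hr0)]
  have hcq : (oppFacet τ q).card = k + 1 := card_oppFacet hq hk
  have hcp : (oppFacet τ p).card = k + 1 := card_oppFacet hp hk
  have hpq' : p ∈ oppFacet τ q := mem_oppFacet.2 ⟨hpq, hp⟩
  have hqp' : q ∈ oppFacet τ p := mem_oppFacet.2 ⟨hpq.symm, hq⟩
  obtain ⟨w, hw, hwd⟩ := exists_weights_dist_eq_altitude
    (Finset.card_pos.1 (by omega : 0 < (oppFacet τ q).card))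
  -- The coefficient of `p` in the foot of the altitude from `q` cannot be small, since moving it to
  -- another vertex would bring the foot into the facet of `oppFacet τ p` opposite to `q`.
  have hlow : Γ ^ k * (k * s) ≤ altitude τ q + |w p| * r := by
    have h1 := (hgood p hp).le_altitude hcp hk1 hqp'
    have h2 : s ≤ Metric.diam (oppFacet τ p : Set (E m)) :=
      le_diam_of_separated (by omega) fun a ha b hb =>
        hsep a (mem_oppFacet.1 ha).2 b (mem_oppFacet.1 hb).2
    have hcpq : (oppFacet (oppFacet τ p) q).card = k := card_oppFacet hqp' hcp
    obtain ⟨v₁, hv₁⟩ := Finset.card_pos.1 (by omega : 0 < (oppFacet (oppFacet τ p) q).card)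
    have heq : oppFacet (oppFacet τ p) q = oppFacet (oppFacet τ q) p := by
      ext v
      simp only [mem_oppFacet]
      tauto
    have hs1 : w p + ∑ v ∈ oppFacet (oppFacet τ p) q, w v = 1 := by
      rw [heq, add_sum_oppFacet hpq', hw]
    have hs2 : w p • p + ∑ v ∈ oppFacet (oppFacet τ p) q, w v • v =
        ∑ v ∈ oppFacet τ q, w v • v := by
      rw [heq]
      exact add_sum_oppFacet hpq' fun v => w v • v
    classical
    have h3 : ∑ v ∈ oppFacet (oppFacet τ p) q, (w v + if v = v₁ then w p else 0) = 1 := by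
      rw [Finset.sum_add_distrib, Finset.sum_ite_eq' _ v₁, if_pos hv₁, ← hs1, add_comm]
    have h4 := altitude_le_dist_sum_smul h3
    have h5 : ∑ v ∈ oppFacet (oppFacet τ p) q, (w v + if v = v₁ then w p else 0) • v =
        ∑ v ∈ oppFacet τ q, w v • v + w p • (v₁ - p) := by
      simp_rw [add_smul, Finset.sum_add_distrib, ite_smul, zero_smul]
      rw [Finset.sum_ite_eq' _ v₁, if_pos hv₁, ← hs2, smul_sub]
      abel
    have h6 : dist v₁ p ≤ r := hr _ (mem_oppFacet.1 (mem_oppFacet.1 hv₁).2).2 _ hp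
    calc Γ ^ k * (k * s) ≤ Γ ^ k * (k * Metric.diam (oppFacet τ p : Set (E m))) := by gcongr
      _ ≤ _ := h1
      _ ≤ _ := h4
      _ ≤ dist q (∑ v ∈ oppFacet τ q, w v • v) + ‖w p • (v₁ - p)‖ := by
        rw [h5]
        refine (dist_triangle _ (∑ v ∈ oppFacet τ q, w v • v) _).trans ?_
        rw [dist_self_add_right]
      _ ≤ altitude τ q + |w p| * r := by
        rw [hwd, norm_smul, Real.norm_eq_abs, ← dist_eq_norm]
        gcongr
  have hup : |w p| * altitude τ p ≤ altitude τ q := by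
    classical
    have h1 : ∑ v ∈ τ, (if v = q then 1 else - w v) = 0 := by
      rw [← add_sum_oppFacet hq, if_pos rfl, Finset.sum_congr rfl fun v hv =>
        if_neg (mem_oppFacet.1 hv).1, Finset.sum_neg_distrib, hw, add_neg_cancel]
    have h2 := abs_mul_altitude_le h1 hp
    have h3 : ∑ v ∈ τ, (if v = q then (1 : ℝ) else - w v) • v =
        q - ∑ v ∈ oppFacet τ q, w v • v := by
      rw [← add_sum_oppFacet hq, if_pos rfl, one_smul, sub_eq_add_neg, ← Finset.sum_neg_distrib]
      congr 1
      exact Finset.sum_congr rfl fun v hv => by rw [if_neg (mem_oppFacet.1 hv).1, neg_smul]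
    rw [h3, ← dist_eq_norm, hwd, if_neg hpq, abs_neg] at h2
    exact h2
  have hG : 0 < Γ ^ k * (k * s) := by positivity
  have hhalf : altitude τ q ≤ Γ ^ k * (k * s) / 2 := by
    refine hq1.trans ?_
    calc Γ ^ (k + 1) * (2 * k * r) = Γ ^ k * k * (4 * Γ * r) / 2 := by ring
      _ ≤ Γ ^ k * k * s / 2 := by gcongr
      _ = _ := by ring
  have h1 : Γ ^ k * (k * s) / 2 ≤ |w p| * r := by linarith
  have h2 : altitude τ p * (Γ ^ k * (k * s) / 2) ≤
      4 * Γ * r ^ 2 / s * (Γ ^ k * (k * s) / 2) := by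
    calc altitude τ p * (Γ ^ k * (k * s) / 2) ≤ altitude τ p * (|w p| * r) :=
          mul_le_mul_of_nonneg_left h1 (altitude_nonneg _ _)
      _ = |w p| * altitude τ p * r := by ring
      _ ≤ Γ ^ (k + 1) * (2 * k * r) * r :=
          mul_le_mul_of_nonneg_right (hup.trans hq1) hr0.le
      _ = _ := by field_simp; ring
  exact le_of_mul_le_mul_right h2 (by linarith)

end Altitudes

/-! ### Nearly cospherical simplices -/

section Cospherical

variable {m : ℕ}

/-- A common weakening of both kinds of forbidden simplices that survives a change of coordinates:
a `(k + 1)`-simplex with `Γ`-good facets and edge lengths between `s` and `r`, each vertex of which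
is within `a` of a point of the affine hull of the opposite facet whose power with respect to the
circumsphere of that facet is at most `b`. The circumsphere is not mentioned: the point is given
by its barycentric coordinates and its power is minus their `inertia`. -/
structure IsNearlyCospherical (Γ s r a b : ℝ) (k : ℕ) (τ : Finset (E m)) : Prop where
  card_eq : τ.card = k + 2
  one_le : 1 ≤ k
  isGood : ∀ p ∈ τ, IsGood Γ (oppFacet τ p)
  le_dist : ∀ p ∈ τ, ∀ q ∈ τ, p ≠ q → s ≤ dist p q
  dist_le : ∀ p ∈ τ, ∀ q ∈ τ, dist p q ≤ r
  exists_weights : ∀ q ∈ τ, ∃ w : E m → ℝ, ∑ v ∈ oppFacet τ q, w v = 1 ∧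
    dist q (∑ v ∈ oppFacet τ q, w v • v) ≤ a ∧ |inertia (oppFacet τ q) w id| ≤ b

/-- If all vertices of `τ` are close to one sphere, then near each vertex there is a point of the
affine hull of the opposite facet with small power. The sphere passes through all vertices but `p`,
so that its power and that of the circumsphere of the facet opposite to `q` differ on this affine
hull by the weight of `p` times the power of `p`. -/
theorem abs_inertia_oppFacet_le {τ : Finset (E m)} {p : E m} (hp : p ∈ τ) {c : E m} {R δ h W : ℝ}
    (hR : 0 ≤ R) (hδ : 0 ≤ δ) (hW : 0 ≤ W) (hc : IsCircumscribing (oppFacet τ p) c R)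
    (hpc : |dist p c - R| ≤ δ) {q : E m} (hq : q ∈ τ) {w : E m → ℝ}
    (hw : ∑ v ∈ oppFacet τ q, w v = 1) (hwW : ∀ v ∈ oppFacet τ q, |w v| ≤ W)
    (hqh : dist q (∑ v ∈ oppFacet τ q, w v • v) ≤ h) :
    |inertia (oppFacet τ q) w id| ≤ (h + δ) * (2 * R + h + δ) + W * (δ * (2 * R + δ)) := by
  have hh : 0 ≤ h := dist_nonneg.trans hqh
  have key : ∀ {x t : ℝ}, |x - R| ≤ t → |x ^ 2 - R ^ 2| ≤ t * (2 * R + t) := by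
    intro x t hx
    have h0 : |x + R| ≤ 2 * R + t := by
      rw [abs_le] at hx ⊢
      constructor <;> linarith
    rw [show x ^ 2 - R ^ 2 = (x - R) * (x + R) by ring, abs_mul]
    exact mul_le_mul hx h0 (abs_nonneg _) ((abs_nonneg _).trans hx)
  have h1 := dist_sum_smul_sq hw id c
  simp only [id] at h1
  have h2 : |dist (∑ v ∈ oppFacet τ q, w v • v) c - dist q c| ≤ h :=
    (abs_dist_sub_le _ _ _).trans (by rwa [dist_comm])
  have hfoot : |dist (∑ v ∈ oppFacet τ q, w v • v) c ^ 2 - R ^ 2| ≤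
      (h + δ) * (2 * R + (h + δ)) := by
    apply key
    have h3 : |dist q c - R| ≤ δ := by
      rcases eq_or_ne q p with rfl | hqp
      · exact hpc
      · rw [hc q (mem_oppFacet.2 ⟨hqp, hq⟩), sub_self, abs_zero]
        exact hδ
    rw [abs_le] at h2 h3 ⊢
    constructor <;> linarith
  have hsum : |∑ v ∈ oppFacet τ q, w v * dist v c ^ 2 - R ^ 2| ≤ W * (δ * (2 * R + δ)) := by
    have h4 : ∑ v ∈ oppFacet τ q, w v * dist v c ^ 2 - R ^ 2 =
        ∑ v ∈ oppFacet τ q, w v * (dist v c ^ 2 - R ^ 2) := by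
      simp_rw [mul_sub, Finset.sum_sub_distrib, ← Finset.sum_mul, hw, one_mul]
    rw [h4]
    by_cases hpq : p ∈ oppFacet τ q
    · rw [Finset.sum_eq_single_of_mem p hpq, abs_mul]
      · exact mul_le_mul (hwW p hpq) (key hpc) (abs_nonneg _) hW
      · intro v hv hvp
        rw [hc v (mem_oppFacet.2 ⟨hvp, (mem_oppFacet.1 hv).2⟩), sub_self, mul_zero]
    · rw [Finset.sum_eq_zero]
      · rw [abs_zero]
        positivity
      · intro v hv
        rw [hc v (mem_oppFacet.2 ⟨?_, (mem_oppFacet.1 hv).2⟩), sub_self, mul_zero]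
        rintro rfl
        exact hpq hv
  have h5 : inertia (oppFacet τ q) w id = (∑ v ∈ oppFacet τ q, w v * dist v c ^ 2 - R ^ 2) -
      (dist (∑ v ∈ oppFacet τ q, w v • v) c ^ 2 - R ^ 2) := by
    rw [h1]
    ring
  rw [h5]
  refine (abs_sub _ _).trans ?_
  linarith

theorem exists_eq_of_card_one {τ : Finset (E m)} {q v : E m} (hv : v ∈ oppFacet τ q)
    (h1 : (oppFacet τ q).card = 1) {w : E m → ℝ}
    (hw : ∑ v ∈ oppFacet τ q, w v = 1) : ∑ v ∈ oppFacet τ q, w v • v = v := by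
  obtain ⟨u, hu⟩ := Finset.card_eq_one.1 h1
  rw [hu, Finset.mem_singleton] at hv
  subst hv
  rw [hu, Finset.sum_singleton] at hw ⊢
  rw [hw, one_smul]

/-- A forbidden configuration is nearly cospherical. It has diameter at most `3 e` and edges of
length at least `μ e / 2`, so that its altitudes are at most
`4 Γ (3 e) ^ 2 / (μ e / 2) = 72 Γ e / μ`. -/
theorem IsForbidden.exists_isNearlyCospherical {Γ μ e δ ε' : ℝ} (hΓ : 0 < Γ) (hμ : 0 < μ)
    (hμ1 : μ ≤ 1) (he : 0 < e) (hΓμ : Γ ≤ μ ^ 4 / 2 ^ 20) (hδ : δ ≤ Γ ^ (m + 1) * μ * e)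
    (hε' : ε' ≤ 5 / 4 * e) {τ : Finset (E m)}
    (hsep : ∀ p ∈ τ, ∀ q ∈ τ, p ≠ q → μ * e / 2 ≤ dist p q) (h : IsForbidden Γ δ ε' τ) :
    ∃ k ≤ m, IsNearlyCospherical Γ (μ * e / 2) ((5 / 2 + μ / 8) * e) (2 ^ 14 * Γ / μ ^ 3 * e)
      (2 ^ 8 * Γ / μ * e ^ 2) k τ := by
  obtain ⟨k, hkm, hk, hflake, p, hp, c, R, hc, hRε, hpc⟩ := h
  have hδ0 : 0 ≤ δ := (abs_nonneg _).trans hpc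
  have hcp := card_oppFacet hp (hk : τ.card = (k + 1) + 1)
  have hR0 : 0 ≤ R := by
    obtain ⟨v, hv⟩ := Finset.card_pos.1 (by omega : 0 < (oppFacet τ p).card)
    rw [← hc v hv]
    exact dist_nonneg
  have hΓμ' : Γ ≤ μ / 2 ^ 20 := hΓμ.trans (by
    gcongr
    calc μ ^ 4 ≤ μ ^ 1 := pow_le_pow_of_le_one hμ.le hμ1 (by norm_num)
      _ = μ := pow_one μ)
  have hΓ2 : Γ ≤ μ ^ 2 / 2 ^ 20 := hΓμ.trans (by
    gcongr ?_ / _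
    exact pow_le_pow_of_le_one hμ.le hμ1 (by norm_num))
  have hΓ1 : Γ ≤ 1 / 2 ^ 20 := hΓμ'.trans (by gcongr)
  have hδ1 : δ ≤ Γ * μ * e := by
    refine hδ.trans ?_
    gcongr
    exact pow_le_of_le_one hΓ.le (by linarith) (by omega)
  have hμe : 0 < μ * e := mul_pos hμ he
  have hδ2 : δ ≤ μ * e / 2 ^ 20 := by
    refine hδ1.trans ?_
    rw [mul_assoc]
    nlinarith
  have hμe1 : μ * e ≤ e := by nlinarith
  have hdist : ∀ a ∈ τ, ∀ b ∈ τ, dist a b ≤ (5 / 2 + μ / 8) * e := by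
    have hne : ∀ a ∈ τ, dist a c ≤ R + δ ∧ (a ≠ p → dist a c = R) := by
      intro a ha
      rcases eq_or_ne a p with rfl | hap
      · exact ⟨by linarith [(abs_le.1 hpc).2], fun h => absurd rfl h⟩
      · have := hc a (mem_oppFacet.2 ⟨hap, ha⟩)
        exact ⟨by linarith, fun _ => this⟩
    intro a ha b hb
    have h1 := dist_triangle_right a b c
    rcases eq_or_ne a p with rfl | hap
    · rcases eq_or_ne b a with rfl | hba
      · rw [dist_self]
        positivity
      · have h2 := (hne b hb).2 hba
        have h3 := (hne a ha).1
        nlinarith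
    · have h2 := (hne a ha).2 hap
      have h3 := (hne b hb).1
      nlinarith
  have hdist' : ∀ a ∈ τ, ∀ b ∈ τ, dist a b ≤ 3 * e := fun a ha b hb =>
    (hdist a ha b hb).trans (by nlinarith)
  obtain ⟨q, hq, hqalt⟩ := hflake.exists_altitude_lt hk
  have hk1 : 1 ≤ k := by
    -- An edge is never a flake: its altitudes are equal to its length.
    by_contra hk0
    obtain rfl : k = 0 := by omega
    have hcq := card_oppFacet hq (hk : τ.card = 1 + 1)
    obtain ⟨v, hv⟩ := Finset.card_pos.1 (by omega : 0 < (oppFacet τ q).card)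
    obtain ⟨w, hw, hwd⟩ := exists_weights_dist_eq_altitude ⟨v, hv⟩
    rw [exists_eq_of_card_one hv hcq hw] at hwd
    have hv' := mem_oppFacet.1 hv
    have h1 := hsep q hq v hv'.2 hv'.1.symm
    have h2 : Metric.diam (τ : Set (E m)) ≤ 3 * e :=
      Metric.diam_le_of_forall_dist_le (by positivity) hdist'
    rw [← hwd] at hqalt
    norm_num at hqalt
    have : Γ * Metric.diam (τ : Set (E m)) ≤ μ / 2 ^ 20 * (3 * e) := by gcongr
    nlinarith
  have hs0 : 0 < μ * e / 2 := by positivity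
  have hΓs : 4 * Γ * (3 * e) ≤ μ * e / 2 := by nlinarith
  have halt : ∀ v ∈ τ, altitude τ v ≤ 72 * Γ / μ * e := by
    intro v hv
    refine (altitude_le_of_altitude_lt hΓ hs0 hΓs hk hk1 hsep hdist' hflake.2 hq hqalt hv).trans
      (le_of_eq ?_)
    field_simp
    norm_num
  have hh1 : 72 * Γ / μ * e ≤ 1 / 8 * e := by
    refine mul_le_mul_of_nonneg_right ?_ he.le
    rw [div_le_iff₀ hμ]
    linarith
  refine ⟨k, hkm, hk, hk1, hflake.2, hsep, hdist, fun v hv => ?_⟩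
  have hcv := card_oppFacet hv (hk : τ.card = (k + 1) + 1)
  obtain ⟨w, hw, hwd⟩ := exists_weights_dist_eq_altitude
    (Finset.card_pos.1 (by omega : 0 < (oppFacet τ v).card))
  have hwd' := hwd.le.trans (halt v hv)
  refine ⟨w, hw, hwd'.trans ?_, ?_⟩
  · have h72 : 72 * Γ / μ ≤ 2 ^ 14 * Γ / μ ^ 3 := by
      rw [div_le_div_iff₀ hμ (by positivity)]
      have : μ ^ 3 ≤ μ ^ 1 := pow_le_pow_of_le_one hμ.le hμ1 (by norm_num)
      nlinarith [mul_pos hΓ hμ, mul_le_mul_of_nonneg_left this hΓ.le]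
    gcongr
  have hk1' : (1 : ℝ) ≤ k := by exact_mod_cast hk1
  have hwW : ∀ u ∈ oppFacet τ v, |w u| ≤ 6 / (Γ ^ k * μ) := by
    intro u hu
    have h1 := (hflake.2 v hv).abs_weight_mul_le hΓ.le hcv hk1
      (le_diam_of_separated (by omega) fun a ha b hb =>
        hsep a (mem_oppFacet.1 ha).2 b (mem_oppFacet.1 hb).2) hw (r := 3 * e) (fun x hx => by
          refine (dist_triangle_left _ _ v).trans ?_
          have := hdist v hv x (mem_oppFacet.1 hx).2
          nlinarith) hu
    rw [le_div_iff₀ (by positivity)]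
    have h2 : |w u| * (Γ ^ k * (1 * (μ * e / 2))) ≤ |w u| * (Γ ^ k * (k * (μ * e / 2))) := by
      gcongr
    have h3 : |w u| * (Γ ^ k * μ) * e ≤ 6 * e := by
      calc _ = 2 * (|w u| * (Γ ^ k * (1 * (μ * e / 2)))) := by ring
        _ ≤ 6 * e := by linarith
    exact le_of_mul_le_mul_right h3 he
  refine (abs_inertia_oppFacet_le hp hR0 hδ0 (by positivity) hc hpc hv hw hwW hwd').trans ?_
  have hA : (72 * Γ / μ * e + δ) * (2 * R + 72 * Γ / μ * e + δ) ≤ (73 * Γ / μ * e) * (3 * e) := by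
    refine mul_le_mul ?_ ?_ (by positivity) (by positivity)
    · have : Γ * μ * e ≤ Γ / μ * e := by
        gcongr
        rw [le_div_iff₀ hμ]
        nlinarith [mul_pos hΓ hμ]
      calc _ ≤ 72 * Γ / μ * e + Γ / μ * e := by linarith
        _ = _ := by ring
    · linarith
  have hB : 6 / (Γ ^ k * μ) * (δ * (2 * R + δ)) ≤ 18 * Γ / μ * e ^ 2 := by
    calc 6 / (Γ ^ k * μ) * (δ * (2 * R + δ)) ≤
          6 / (Γ ^ k * μ) * ((Γ ^ (k + 1) * μ * e) * (3 * e)) := by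
          gcongr
          · refine hδ.trans ?_
            gcongr ?_ * _ * _
            exact pow_le_pow_of_le_one hΓ.le (by linarith) (by omega)
          · linarith
      _ = 18 * Γ * e ^ 2 := by field_simp; ring
      _ ≤ 18 * Γ / μ * e ^ 2 := by
        gcongr
        rw [le_div_iff₀ hμ]
        nlinarith
  calc _ ≤ (73 * Γ / μ * e) * (3 * e) + 18 * Γ / μ * e ^ 2 := add_le_add hA hB
    _ = 237 * (Γ / μ * e ^ 2) := by ring
    _ ≤ 2 ^ 8 * (Γ / μ * e ^ 2) := by gcongr; norm_num
    _ = _ := by ring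

/-- The hoop property provides points of the circumspheres themselves, which have power zero. -/
theorem HasForbiddenProperties.exists_isNearlyCospherical {Γ μ e δ₀ : ℝ} (hΓ : 0 < Γ) (hμ : 0 < μ)
    (he : 0 < e) (hΓμ : Γ ≤ μ ^ 4 / 2 ^ 20) (hδ : δ₀ ≤ 1 / 10)
    {τ : Finset (E m)}
    (hsep : ∀ p ∈ τ, ∀ q ∈ τ, p ≠ q → μ * e / 2 ≤ dist p q)
    (h : HasForbiddenProperties μ e Γ δ₀ τ) :
    ∃ k ≤ m, IsNearlyCospherical Γ (μ * e / 2) ((5 / 2 + μ / 8) * e) (2 ^ 14 * Γ / μ ^ 3 * e)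
      (2 ^ 8 * Γ / μ * e ^ 2) k τ := by
  obtain ⟨k, hkm, hk, hhoop, hrad, hdiam, hgood⟩ := h
  have hdist : ∀ a ∈ τ, ∀ b ∈ τ, dist a b ≤ (5 / 2 + μ / 8) * e := by
    intro a ha b hb
    refine (Metric.dist_le_diam_of_mem τ.finite_toSet.isBounded ha hb).trans (hdiam.le.trans ?_)
    have : δ₀ * μ ≤ 1 / 10 * μ := by gcongr
    gcongr
    linarith
  have hweights : ∀ q ∈ τ, ∃ w : E m → ℝ, ∑ v ∈ oppFacet τ q, w v = 1 ∧
      dist q (∑ v ∈ oppFacet τ q, w v • v) ≤ 2 ^ 14 * Γ / μ ^ 3 * e ∧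
      inertia (oppFacet τ q) w id = 0 := by
    intro q hq
    obtain ⟨c, R, hcR, hinf⟩ := hhoop q hq
    obtain ⟨c', R', hcR', hR'⟩ := hrad q hq
    have hR : R < 2 * e := (hcR.2 c' R' hcR'.1).trans_lt hR'
    have hcq := card_oppFacet hq (hk : τ.card = (k + 1) + 1)
    obtain ⟨v, hv⟩ := Finset.card_pos.1 (by omega : 0 < (oppFacet τ q).card)
    obtain ⟨x, ⟨hx1, hx2⟩, hd⟩ := (Metric.isClosed_sphere.inter
      (AffineSubspace.closed_of_finiteDimensional
        (affineSpan ℝ (oppFacet τ q : Set (E m))))).exists_infDist_eq_dist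
      ⟨v, Metric.mem_sphere.2 (hcR.1 v hv), subset_affineSpan ℝ _ hv⟩ q
    obtain ⟨w, hw, rfl⟩ := exists_weights_of_mem_affineSpan hx2
    refine ⟨w, hw, ?_, ?_⟩
    · rw [← hd]
      refine hinf.trans ?_
      calc 2 ^ 13 * Γ / μ ^ 3 * R ≤ 2 ^ 13 * Γ / μ ^ 3 * (2 * e) := by gcongr
        _ = _ := by ring
    · have h1 := dist_sum_smul_sq_of_dist_eq hw (f := id) (c := c) (R := R)
        (fun v hv => hcR.1 v hv)
      simp only [id] at h1
      rw [Metric.mem_sphere.1 hx1] at h1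
      linarith
  have hk1 : 1 ≤ k := by
    -- For an edge the hoop property says that its vertices are closer than the separation permits.
    by_contra hk0
    obtain rfl : k = 0 := by omega
    obtain ⟨q, hq⟩ := Finset.card_pos.1 (by omega : 0 < τ.card)
    have hcq := card_oppFacet hq (hk : τ.card = 1 + 1)
    obtain ⟨v, hv⟩ := Finset.card_pos.1 (by omega : 0 < (oppFacet τ q).card)
    obtain ⟨w, hw, hwd, -⟩ := hweights q hq
    rw [exists_eq_of_card_one hv hcq hw] at hwd
    have hv' := mem_oppFacet.1 hv
    have h1 := hsep q hq v hv'.2 hv'.1.symm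
    have h2 : 2 ^ 14 * Γ / μ ^ 3 ≤ μ / 64 := by
      rw [div_le_iff₀ (by positivity)]
      calc 2 ^ 14 * Γ ≤ 2 ^ 14 * (μ ^ 4 / 2 ^ 20) := by gcongr
        _ = _ := by ring
    have h3 : 2 ^ 14 * Γ / μ ^ 3 * e ≤ μ / 64 * e := by gcongr
    nlinarith [mul_pos hμ he]
  refine ⟨k, hkm, hk, hk1, hgood, hsep, hdist, fun q hq => ?_⟩
  obtain ⟨w, hw, hwd, hw0⟩ := hweights q hq
  refine ⟨w, hw, hwd, ?_⟩
  rw [hw0, abs_zero]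
  positivity

end Cospherical

/-! ### Volume estimates -/

section Volume

variable {m : ℕ}

theorem volumeReal_ball (x : E m) {r : ℝ} (hr : 0 < r) :
    volume.real (ball x r) = r ^ m * volume.real (ball (0 : E m) 1) := by
  rw [measureReal_def, Measure.addHaar_ball_of_pos volume x hr, ENNReal.toReal_mul,
    ENNReal.toReal_ofReal (by positivity), finrank_euclideanSpace_fin, measureReal_def]

theorem volumeReal_ball_pos (x : E m) {r : ℝ} (hr : 0 < r) : 0 < volume.real (ball x r) :=
  ENNReal.toReal_pos (measure_ball_pos volume x hr).ne' measure_ball_lt_top.ne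

theorem sum_volumeReal_le_of_disjoint {ι : Type*} {s : Finset ι} {A : ι → Set (E m)} {B : Set (E m)}
    (hA : ∀ i ∈ s, MeasurableSet (A i)) (hd : (s : Set ι).PairwiseDisjoint A)
    (hAB : ∀ i ∈ s, A i ⊆ B) (hB : volume B ≠ ⊤) : ∑ i ∈ s, volume.real (A i) ≤ volume.real B := by
  rw [← measureReal_biUnion_finset hd hA fun i hi => ne_top_of_le_ne_top hB (measure_mono (hAB i
    hi))]
  exact measureReal_mono (Set.iUnion₂_subset hAB) hB

/-- The part of a spherical shell in a ball, for a sphere that is not small compared to the ball: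
dilating it from the centre of the shell gives many disjoint copies in a ball of twice the
radius, each of at least the same volume. -/
theorem volumeReal_shell_le_of_lt {p c : E m} {r R w : ℝ} (hw : 0 < w) (hwr : w ≤ r / 8)
    (hR : r < R + w) :
    volume.real (ball p r ∩ {x | |dist x c - R| ≤ w}) ≤
      6 * 2 ^ m * (w / r) * volume.real (ball p r) := by
  set A := ball p r ∩ {x | |dist x c - R| ≤ w} with hAdef
  have hr : 0 < r := by linarith
  set b := R + w with hb
  have hb0 : 0 < b := hr.trans hR
  set N := ⌊r / (6 * w)⌋₊ + 1 with hN
  have hNr : r / (6 * w) ≤ N := by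
    rw [hN]
    push_cast
    exact (Nat.lt_floor_add_one _).le
  have hjr : ∀ j < N, 6 * w * j ≤ r := by
    intro j hj
    have h1 : (j : ℝ) ≤ r / (6 * w) :=
      (Nat.cast_le.2 (Nat.lt_succ_iff.1 hj)).trans (Nat.floor_le (by positivity))
    rw [le_div_iff₀ (by positivity)] at h1
    linarith
  -- The factors grow slowly enough to displace points of the shell by at most `r`, and fast enough
  -- to make the dilated shells disjoint.
  let s : ℕ → ℝ := fun j => 1 + 6 * w * j / b
  have hs1 : ∀ j, 1 ≤ s j := fun j => le_add_of_nonneg_right (by positivity)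
  have hsb : ∀ j, s j * b = b + 6 * w * j := fun j => by
    simp only [s]
    field_simp
  have hAm : MeasurableSet A := by
    refine isOpen_ball.measurableSet.inter (IsClosed.measurableSet ?_)
    exact isClosed_le (by fun_prop) (by fun_prop)
  have hdistT : ∀ j x, dist (AffineMap.homothety c (s j) x) c = s j * dist x c := by
    intro j x
    rw [dist_homothety_center, Real.norm_eq_abs, abs_of_pos (by linarith [hs1 j]), dist_comm c x]
  have hxA : ∀ x ∈ A, b - 2 * w ≤ dist x c ∧ dist x c ≤ b := by
    intro x hx
    have := abs_le.1 (Set.mem_ofPred.1 hx.2)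
    exact ⟨by linarith [this.1], by linarith [this.2]⟩
  have hle : ∑ j ∈ Finset.range N, volume.real (AffineMap.homothety c (s j) '' A) ≤
      volume.real (ball p (2 * r)) := by
    refine sum_volumeReal_le_of_disjoint ?_ ?_ ?_ measure_ball_lt_top.ne
    · intro j _
      refine hAm.image_of_continuousOn_injOn (AffineMap.continuous_of_finiteDimensional
        _).continuousOn
        (Function.Injective.injOn ?_)
      have h0 : s j ≠ 0 := by linarith [hs1 j]
      intro x y hxy
      simp only [AffineMap.homothety_apply, vsub_eq_sub, vadd_eq_add, add_left_inj] at hxy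
      simpa [sub_left_inj] using smul_right_injective (E m) h0 hxy
    · have hlt : ∀ i < N, ∀ j < N, i < j → Disjoint (AffineMap.homothety c (s i) '' A)
          (AffineMap.homothety c (s j) '' A) := by
        intro i hi j hj hij
        rw [Set.disjoint_left]
        rintro _ ⟨x, hx, rfl⟩ ⟨y, hy, hxy⟩
        have h1 := congrArg (fun z => dist z c) hxy
        simp only [hdistT] at h1
        have h2 : s i * dist x c ≤ b + 6 * w * i := by
          rw [← hsb]
          exact mul_le_mul_of_nonneg_left (hxA x hx).2 (by linarith [hs1 i])
        have h3 : s j * (b - 2 * w) ≤ s j * dist y c :=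
          mul_le_mul_of_nonneg_left (hxA y hy).1 (by linarith [hs1 j])
        have h4 : (i : ℝ) + 1 ≤ j := by exact_mod_cast hij
        have h5 : s j ≤ 2 := by
          have := hjr j hj
          simp only [s]
          have : 6 * w * j / b ≤ 1 := by
            rw [div_le_one hb0]
            linarith
          linarith
        have h6 := hsb j
        nlinarith
      intro i hi j hj hij
      have hi' : i < N := by simpa using hi
      have hj' : j < N := by simpa using hj
      rcases lt_or_gt_of_ne hij with h | h
      · exact hlt i hi' j hj' h
      · exact (hlt j hj' i hi' h).symm
    · rintro j hj _ ⟨x, hx, rfl⟩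
      have hj' := hjr j (Finset.mem_range.1 hj)
      have h1 : dist (AffineMap.homothety c (s j) x) x ≤ r := by
        rw [dist_homothety_self, Real.norm_eq_abs, abs_sub_comm,
          abs_of_nonneg (by linarith [hs1 j])]
        have : s j - 1 = 6 * w * j / b := by simp only [s]; ring
        rw [this, dist_comm]
        calc 6 * w * j / b * dist x c ≤ 6 * w * j / b * b := by
              gcongr
              exact (hxA x hx).2
          _ = 6 * w * j := by field_simp
          _ ≤ r := hj'
      have h2 : dist x p < r := hx.1
      rw [mem_ball]
      linarith [dist_triangle (AffineMap.homothety c (s j) x) x p]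
  have hge : N * volume.real A ≤
      ∑ j ∈ Finset.range N, volume.real (AffineMap.homothety c (s j) '' A) := by
    rw [← nsmul_eq_mul, ← Finset.card_range N, ← Finset.sum_const, Finset.card_range]
    refine Finset.sum_le_sum fun j _ => ?_
    rw [measureReal_def, measureReal_def, Measure.addHaar_image_homothety, ENNReal.toReal_mul,
      ENNReal.toReal_ofReal (abs_nonneg _)]
    refine le_mul_of_one_le_left ENNReal.toReal_nonneg ?_
    rw [abs_of_pos (pow_pos (by linarith [hs1 j]) _)]
    exact one_le_pow₀ (hs1 j)
  have h1 : r / (6 * w) * volume.real A ≤ 2 ^ m * volume.real (ball p r) := by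
    rw [volumeReal_ball p hr, ← mul_assoc, ← mul_pow, ← volumeReal_ball p (by positivity)]
    exact (mul_le_mul_of_nonneg_right hNr measureReal_nonneg).trans (hge.trans hle)
  calc volume.real A = 6 * (w / r) * (r / (6 * w) * volume.real A) := by field_simp
    _ ≤ 6 * (w / r) * (2 ^ m * volume.real (ball p r)) := by gcongr
    _ = _ := by ring

theorem volumeReal_shell_le_of_le (hm : 1 ≤ m) {p c : E m} {r R w : ℝ} (hw : 0 < w) (hR0 : 0 ≤ R)
    (hR : R + w ≤ r) :
    volume.real (ball p r ∩ {x | |dist x c - R| ≤ w}) ≤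
      2 * m * (w / r) * volume.real (ball p r) := by
  have hr : 0 < r := by linarith
  set b := R + w with hb
  have hb0 : 0 < b := by linarith
  set a := max (R - w) 0 with ha
  have ha0 : 0 ≤ a := le_max_right _ _
  have hab : a ≤ b := max_le (by linarith) hb0.le
  have hba : b - a ≤ 2 * w := by linarith [le_max_left (R - w) 0]
  have hdiff : volume.real (ball p r ∩ {x | |dist x c - R| ≤ w}) ≤
      volume.real (closedBall c b) - volume.real (ball c a) := by
    have hsub : ball c a ⊆ closedBall c b := (ball_subset_ball hab).trans ball_subset_closedBall
    rw [← measureReal_sdiff hsub measurableSet_ball measure_closedBall_lt_top.ne]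
    refine measureReal_mono (fun x hx => ⟨?_, ?_⟩)
      (ne_top_of_le_ne_top measure_closedBall_lt_top.ne (measure_mono Set.sdiff_subset))
    · rw [mem_closedBall]
      linarith [(abs_le.1 (Set.mem_ofPred.1 hx.2)).2]
    · rw [mem_ball, not_lt]
      exact max_le (by linarith [(abs_le.1 (Set.mem_ofPred.1 hx.2)).1]) dist_nonneg
  have : Nonempty (Fin m) := ⟨⟨0, hm⟩⟩
  have hcl : volume.real (closedBall c b) = b ^ m * volume.real (ball (0 : E m) 1) := by
    rw [measureReal_def, Measure.addHaar_closedBall_eq_addHaar_ball, ← measureReal_def,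
      volumeReal_ball c hb0]
  have hop : volume.real (ball c a) = a ^ m * volume.real (ball (0 : E m) 1) := by
    rcases ha0.eq_or_lt with h0 | h0
    · rw [← h0, ball_zero, measureReal_empty, zero_pow (by omega), zero_mul]
    · exact volumeReal_ball c h0
  rw [hcl, hop, ← sub_mul] at hdiff
  rw [volumeReal_ball p hr, ← mul_assoc]
  refine hdiff.trans (mul_le_mul_of_nonneg_right ?_ measureReal_nonneg)
  obtain ⟨l, rfl⟩ := Nat.exists_eq_add_of_le' hm
  -- Bernoulli's inequality for `(a / b) ^ m`
  have h1 := one_add_mul_le_pow (a := a / b - 1) (by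
    have : 0 ≤ a / b := by positivity
    linarith) (l + 1)
  rw [add_sub_cancel, div_pow, le_div_iff₀ (by positivity)] at h1
  calc b ^ (l + 1) - a ^ (l + 1) ≤ (l + 1 : ℕ) * (1 - a / b) * b ^ (l + 1) := by linarith
    _ = (l + 1 : ℕ) * (b - a) * b ^ l := by
      field_simp
      ring
    _ ≤ (l + 1 : ℕ) * (2 * w) * r ^ l := by gcongr
    _ = _ := by
      field_simp
      ring

/-- A shell of width `2 w` fills at most the fraction `6 * 2 ^ m * (w / r)` of a ball of radius `r`,
whatever the radius of the shell. -/
theorem volumeReal_shell_le (hm : 1 ≤ m) (p c : E m) {r R w : ℝ} (hw : 0 < w) (hwr : w ≤ r / 8)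
    (hR0 : 0 ≤ R) :
    volume.real (ball p r ∩ {x | |dist x c - R| ≤ w}) ≤
      6 * 2 ^ m * (w / r) * volume.real (ball p r) := by
  rcases lt_or_ge r (R + w) with h | h
  · exact volumeReal_shell_le_of_lt hw hwr h
  · refine (volumeReal_shell_le_of_le hm hw hR0 h).trans ?_
    have hr : 0 < r := by linarith
    have h2 : (m : ℝ) ≤ 2 ^ m := by exact_mod_cast Nat.lt_two_pow_self.le
    gcongr
    norm_num

theorem exists_mem_ball_forall_lt_abs_sub {ι : Type*} (hm : 1 ≤ m) (S : Finset ι) (p : E m)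
    (c : ι → E m) (R : ι → ℝ) (hR : ∀ s ∈ S, 0 ≤ R s) {r w : ℝ} (hw : 0 < w) (hwr : w ≤ r / 8)
    (hS : S.card * (6 * 2 ^ m * (w / r)) < 1) :
    ∃ x ∈ ball p r, ∀ s ∈ S, w < |dist x (c s) - R s| := by
  by_contra! hcon
  have hr : 0 < r := by linarith
  have hpos := volumeReal_ball_pos p hr
  have h1 : ball p r ⊆ ⋃ s ∈ S, ball p r ∩ {x | |dist x (c s) - R s| ≤ w} := by
    intro x hx
    obtain ⟨s, hs, hxs⟩ := hcon x hx
    exact Set.mem_iUnion₂.2 ⟨s, hs, hx, hxs⟩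
  have h2 : volume.real (ball p r) ≤
      S.card * (6 * 2 ^ m * (w / r) * volume.real (ball p r)) := by
    refine (measureReal_mono h1 ?_).trans ((measureReal_biUnion_finset_le _ _).trans ?_)
    · exact ne_top_of_le_ne_top measure_ball_lt_top.ne
        (measure_mono (Set.iUnion₂_subset fun s _ => Set.inter_subset_left) :
          _ ≤ volume (ball p r))
    · rw [← nsmul_eq_mul, ← Finset.sum_const]
      exact Finset.sum_le_sum fun s hs => volumeReal_shell_le hm p (c s) hw hwr (hR s hs)
  rw [← mul_assoc] at h2
  nlinarith

/-- Packing bound: the balls of radius `s / 2` around the points are disjoint. -/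
theorem card_le_of_separated {P : Finset (E m)} {p : E m} {r s : ℝ} (hs : 0 < s)
    (hr : 0 ≤ r) (hP : ∀ x ∈ P, dist x p ≤ r)
    (hsep : ∀ x ∈ P, ∀ y ∈ P, x ≠ y → s ≤ dist x y) : (P.card : ℝ) ≤ ((2 * r + s) / s) ^ m := by
  have h1 : ∑ x ∈ P, volume.real (ball x (s / 2)) ≤ volume.real (ball p (r + s / 2)) := by
    refine sum_volumeReal_le_of_disjoint (fun _ _ => measurableSet_ball) ?_ ?_
      measure_ball_lt_top.ne
    · intro x hx y hy hxy
      refine ball_disjoint_ball ?_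
      linarith [hsep x hx y hy hxy]
    · intro x hx
      refine ball_subset_ball' ?_
      linarith [hP x hx]
  have hV := volumeReal_ball_pos (0 : E m) one_pos
  simp_rw [volumeReal_ball _ (by positivity : 0 < s / 2)] at h1
  rw [Finset.sum_const, nsmul_eq_mul, volumeReal_ball p (by positivity), ← mul_assoc] at h1
  have h2 := le_of_mul_le_mul_right h1 hV
  rw [← le_div_iff₀ (by positivity), ← div_pow] at h2
  refine h2.trans (le_of_eq ?_)
  congr 1
  field_simp

end Volume

/-! ### Consequences of the parameter constraints -/

section Parameters

variable {m : ℕ} {μ₀ ε₀ ξ₀ ρ₀ : ℝ}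

theorem paramC_pos (hm : 1 ≤ m) (hμ : 0 < μ₀) : 0 < paramC m μ₀ := by
  have : (0 : ℝ) < m := by exact_mod_cast hm
  exact mul_pos (Real.rpow_pos_of_pos this _) (by positivity)

theorem tildeAlpha_eq (hm : 1 ≤ m) (hμ : 0 < μ₀) :
    tildeAlpha m μ₀ ρ₀ = 2 ^ 16 * ρ₀ / (μ₀ ^ 3 * (2 / μ₀) ^ (4 * m ^ 2 + 5 * m + 21)) := by
  have h0 : (0 : ℝ) < m := by exact_mod_cast hm
  have h1 : (0 : ℝ) < (m : ℝ) ^ (3 / 2 : ℝ) := Real.rpow_pos_of_pos h0 _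
  have h2 : (0 : ℝ) < (2 / μ₀) ^ (4 * m ^ 2 + 5 * m + 21) := by positivity
  rw [tildeAlpha, gammaZero, paramC]
  generalize (2 / μ₀) ^ (4 * m ^ 2 + 5 * m + 21) = t at *
  field_simp

namespace ParameterConstraints

variable (h : ParameterConstraints m μ₀ ε₀ ξ₀ ρ₀)

include h

theorem one_le_rpow : 1 ≤ (m : ℝ) ^ (3 / 2 : ℝ) :=
  Real.one_le_rpow (by exact_mod_cast h.dim_pos) (by norm_num)

theorem gammaZero_pos : 0 < gammaZero m μ₀ ρ₀ :=
  div_pos h.rho_pos (paramC_pos h.dim_pos h.mu_pos)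

theorem one_add_mul_one_add_le : (1 + ε₀) * (1 + ξ₀) ≤ 2 := by
  have h1 : 0 < 1 + ξ₀ := by linarith [h.xi_nonneg]
  have h2 := h.eps_le
  rw [le_div_iff₀ h1] at h2
  linarith

theorem eps_le_one : ε₀ ≤ 1 := by
  nlinarith [h.one_add_mul_one_add_le, h.xi_nonneg, h.eps_nonneg]

theorem one_add_xi_mul_rho_le : (1 + ξ₀) * ρ₀ ≤ tildeRho ε₀ ξ₀ ρ₀ := by
  rw [tildeRho, mul_assoc]
  refine le_mul_of_one_le_left ?_ (by linarith [h.eps_nonneg])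
  exact mul_nonneg (by linarith [h.xi_nonneg]) h.rho_pos.le

theorem rho_le_tildeRho : ρ₀ ≤ tildeRho ε₀ ξ₀ ρ₀ := by
  refine le_trans ?_ h.one_add_xi_mul_rho_le
  nlinarith [h.xi_nonneg, h.rho_pos]

theorem tildeRho_pos : 0 < tildeRho ε₀ ξ₀ ρ₀ := h.rho_pos.trans_le h.rho_le_tildeRho

theorem gammaZero_le : gammaZero m μ₀ ρ₀ ≤ μ₀ ^ 4 / 2 ^ 20 := by
  have hμ := h.mu_pos
  have h1 : (2 / μ₀) ^ 30 ≤ paramC m μ₀ := by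
    have h2 : (1 : ℝ) ≤ 2 / μ₀ := by
      rw [le_div_iff₀ hμ]
      linarith [h.mu_le_one]
    have h3 : 30 ≤ 4 * m ^ 2 + 5 * m + 21 := by nlinarith [h.dim_pos]
    calc (2 / μ₀) ^ 30 ≤ 1 * (2 / μ₀) ^ (4 * m ^ 2 + 5 * m + 21) := by
          rw [one_mul]
          exact pow_le_pow_right₀ h2 h3
      _ ≤ _ := by
          rw [paramC]
          gcongr
          exact h.one_le_rpow
  calc gammaZero m μ₀ ρ₀ ≤ (μ₀ / 4) / (2 / μ₀) ^ 30 := by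
        rw [gammaZero]
        gcongr
        exact h.rho_le_tildeRho.trans h.rho_le
    _ = μ₀ ^ 31 / 2 ^ 32 := by field_simp; norm_num
    _ ≤ μ₀ ^ 4 / 2 ^ 20 := by
        gcongr ?_ / ?_
        · exact pow_le_pow_of_le_one hμ.le h.mu_le_one (by norm_num)
        · norm_num

end ParameterConstraints

end Parameters

/-! ### Existence of good perturbations -/

section Circumcentre

variable {m : ℕ}

theorem IsCircumcentre.radius_nonneg {σ : Finset (E m)} (hσ : σ.Nonempty) {c : E m} {R : ℝ}
    (h : IsCircumcentre σ c R) : 0 ≤ R := by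
  obtain ⟨v, hv⟩ := hσ
  rw [← h.1 v hv]
  exact dist_nonneg

theorem IsCircumcentre.unique {σ : Finset (E m)} (hσ : σ.Nonempty) {c c' : E m} {R R' : ℝ}
    (h : IsCircumcentre σ c R) (h' : IsCircumcentre σ c' R') : c = c' ∧ R = R' := by
  obtain rfl : R = R' := le_antisymm (h.2 c' R' h'.1) (h'.2 c R h.1)
  refine ⟨?_, rfl⟩
  have hR := h.radius_nonneg hσ
  -- If `c ≠ c'`, the midpoint is the centre of a smaller circumscribing ball.
  have hmid : ∀ v ∈ σ, dist v ((1 / 2 : ℝ) • (c + c')) ^ 2 = R ^ 2 - dist c c' ^ 2 / 4 := by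
    intro v hv
    have h1 := h.1 v hv
    have h2 := h'.1 v hv
    have h3 := parallelogram_law_with_norm ℝ (v - c) (v - c')
    rw [← dist_eq_norm v c, ← dist_eq_norm v c', h1, h2, sub_sub_sub_cancel_left,
      ← dist_eq_norm, dist_comm c' c] at h3
    have h4 : v - (1 / 2 : ℝ) • (c + c') = (1 / 2 : ℝ) • ((v - c) + (v - c')) := by module
    rw [dist_eq_norm, h4, norm_smul, Real.norm_eq_abs, abs_of_pos (by norm_num), mul_pow]
    linarith
  have hle := h.2 ((1 / 2 : ℝ) • (c + c')) (√(R ^ 2 - dist c c' ^ 2 / 4)) fun v hv => by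
    rw [← hmid v hv, Real.sqrt_sq dist_nonneg]
  obtain ⟨v, hv⟩ := hσ
  have h0 : 0 ≤ R ^ 2 - dist c c' ^ 2 / 4 := by
    rw [← hmid v hv]
    positivity
  have h5 := (Real.le_sqrt hR h0).1 hle
  rw [← dist_eq_zero]
  nlinarith [dist_nonneg (x := c) (y := c')]

theorem sphere_nonempty_of_one_le (hm : 1 ≤ m) (c : E m) {R : ℝ} (hR : 0 ≤ R) :
    (sphere c R).Nonempty := by
  have : Nonempty (Fin m) := ⟨⟨0, hm⟩⟩
  exact NormedSpace.sphere_nonempty.2 hR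

theorem abs_dist_sub_le_infDist_sphere (hm : 1 ≤ m) (x c : E m) {R : ℝ} (hR : 0 ≤ R) :
    |dist x c - R| ≤ infDist x (sphere c R) := by
  refine (le_infDist (sphere_nonempty_of_one_le hm c hR)).2 fun y hy => ?_
  rw [← mem_sphere.1 hy]
  exact abs_dist_sub_le x y c

theorem infDist_sphere_le (hm : 1 ≤ m) (x c : E m) {R : ℝ} (hR : 0 ≤ R) :
    infDist x (sphere c R) ≤ |dist x c - R| := by
  rcases eq_or_ne x c with rfl | hxc
  · obtain ⟨y, hy⟩ := sphere_nonempty_of_one_le hm x hR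
    refine (infDist_le_dist_of_mem hy).trans ?_
    rw [dist_comm, mem_sphere.1 hy, dist_self, zero_sub, abs_neg]
    exact le_abs_self R
  · -- The nearest point of the sphere is the radial projection.
    have hd : 0 < dist x c := dist_pos.2 hxc
    have hy : c + (R / dist x c) • (x - c) ∈ sphere c R := by
      rw [mem_sphere, dist_self_add_left, norm_smul, ← dist_eq_norm, Real.norm_eq_abs,
        abs_of_nonneg (by positivity), div_mul_cancel₀ _ hd.ne']
    refine (infDist_le_dist_of_mem hy).trans (le_of_eq ?_)
    have h1 : x - (c + (R / dist x c) • (x - c)) = ((dist x c - R) / dist x c) • (x - c) := by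
      rw [sub_div, div_self hd.ne']
      module
    rw [dist_eq_norm, h1, norm_smul, ← dist_eq_norm, Real.norm_eq_abs, abs_div,
      abs_of_pos hd, div_mul_cancel₀ _ hd.ne']

end Circumcentre

namespace Input

variable {m n : ℕ} {M : Type*} [TopologicalSpace M] (D : Input m n M) {μ₀ ε₀ ξ₀ ρ₀ : ℝ}

theorem coord_injOn (i : Fin n) : Set.InjOn (D.coord i) (D.nbrs i) := fun _ ha _ hb h =>
  D.pt_injective ((D.chart i).injOn ha hb h)

/-- The number of simplices to be avoided is bounded in terms of `m` and `μ₀`. -/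
theorem ncard_nearSimplices_le (hinput : D.InputAssumptions μ₀ ε₀ ξ₀) (hμ : 0 < μ₀)
    (hμ1 : μ₀ ≤ 1) (i : Fin n) :
    ((D.nearSimplices μ₀ i).ncard : ℝ) ≤ (14 / μ₀) ^ (m * (m + 1)) := by
  classical
  have he := D.radius_pos i
  let L : Finset (Fin n) := Finset.univ.filter fun l => l ∈ D.nbrs i ∧
    D.coord i l ∈ ball (D.centre i) ((5 + 3 * μ₀ / 2) * D.radius i)
  have hL : (L.card : ℝ) ≤ (14 / μ₀) ^ m := by
    have hinj : Set.InjOn (D.coord i) L := (D.coord_injOn i).mono fun l hl => by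
      simp only [L, Finset.coe_filter, Finset.mem_univ, true_and] at hl
      exact hl.1
    have hmem : ∀ x ∈ L.image (D.coord i), x ∈ D.coord i '' D.nbrs i ∧
        dist x (D.centre i) < (5 + 3 * μ₀ / 2) * D.radius i := by
      intro x hx
      obtain ⟨l, hl, rfl⟩ := Finset.mem_image.1 hx
      simp only [L, Finset.mem_filter, Finset.mem_univ, true_and] at hl
      exact ⟨⟨l, hl.1, rfl⟩, hl.2⟩
    rw [← Finset.card_image_of_injOn hinj]
    refine (card_le_of_separated (mul_pos hμ he) (by positivity) (fun x hx => (hmem x hx).2.le)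
      fun x hx y hy => (hinput.net i).separated x (hmem x hx).1 y (hmem y hy).1).trans ?_
    gcongr ?_ ^ m
    rw [div_le_div_iff₀ (by positivity) hμ]
    have : 0 < μ₀ * D.radius i := by positivity
    nlinarith
  have hsub : D.nearSimplices μ₀ i ⊆ (L.powersetCard (m + 1) : Finset (Finset (Fin n))) := by
    intro s hs
    rw [Finset.mem_coe, Finset.mem_powersetCard]
    refine ⟨fun l hl => ?_, hs.1⟩
    simp only [L, Finset.mem_filter, Finset.mem_univ, true_and]
    exact (hs.2 l hl).2
  have h1 := Set.ncard_le_ncard hsub (Finset.finite_toSet _)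
  rw [Set.ncard_coe_finset, Finset.card_powersetCard] at h1
  calc ((D.nearSimplices μ₀ i).ncard : ℝ) ≤ (L.card ^ (m + 1) : ℕ) := by
        exact_mod_cast h1.trans (Nat.choose_le_pow _ _)
    _ ≤ ((14 / μ₀) ^ m) ^ (m + 1) := by
        push_cast
        gcongr
    _ = _ := by rw [pow_mul]

theorem finite_nearSimplices (i : Fin n) : (D.nearSimplices μ₀ i).Finite := Set.toFinite _

theorem isOpen_setOf_isGoodPerturbation (q : Fin n → M) (i : Fin n) :
    IsOpen {x | D.IsGoodPerturbation μ₀ ρ₀ q i x} := by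
  classical
  have h : {x | D.IsGoodPerturbation μ₀ ρ₀ q i x} =
      (⋃ s ∈ D.nearSimplices μ₀ i, {x | ∃ (c : E m) (R : ℝ),
        IsCircumcentre (s.image fun l => D.chart i (q l)) c R ∧
        infDist x (sphere c R) ≤ 2 * tildeAlpha m μ₀ ρ₀ * D.radius i})ᶜ := by
    ext x
    simp [IsGoodPerturbation]
  rw [h, isOpen_compl_iff]
  refine (D.finite_nearSimplices i).isClosed_biUnion fun s hs => ?_
  have hne : (s.image fun l => D.chart i (q l)).Nonempty :=
    Finset.Nonempty.image (Finset.card_pos.1 (by have := hs.1; omega)) _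
  by_cases hc : ∃ (c : E m) (R : ℝ), IsCircumcentre (s.image fun l => D.chart i (q l)) c R
  · obtain ⟨c, R, hcR⟩ := hc
    have hcl : IsClosed {x | infDist x (sphere c R) ≤ 2 * tildeAlpha m μ₀ ρ₀ * D.radius i} :=
      isClosed_le (continuous_infDist_pt (sphere c R)) continuous_const
    have heq : ∀ x, (∃ (c' : E m) (R' : ℝ),
        IsCircumcentre (s.image fun l => D.chart i (q l)) c' R' ∧
        infDist x (sphere c' R') ≤ 2 * tildeAlpha m μ₀ ρ₀ * D.radius i) ↔
        infDist x (sphere c R) ≤ 2 * tildeAlpha m μ₀ ρ₀ * D.radius i := by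
      refine fun x => ⟨?_, fun hx => ⟨c, R, hcR, hx⟩⟩
      rintro ⟨c', R', hcR', hx⟩
      obtain ⟨rfl, rfl⟩ := hcR.unique hne hcR'
      exact hx
    simp only [heq]
    exact hcl
  · convert isClosed_empty
    ext x
    simp only [Set.mem_empty_iff_false, iff_false]
    rintro ⟨c, R, hcR, -⟩
    exact hc ⟨c, R, hcR⟩

/-- Whatever the current positions are, there is a good perturbation: the shells to be avoided do
not fill the ball of all perturbations. -/
theorem exists_isGoodPerturbation (hinput : D.InputAssumptions μ₀ ε₀ ξ₀)
    (hparam : ParameterConstraints m μ₀ ε₀ ξ₀ ρ₀) (q : Fin n → M) (i : Fin n) :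
    ∃ x ∈ ball (D.centre i) (ρ₀ * D.radius i), D.IsGoodPerturbation μ₀ ρ₀ q i x := by
  classical
  have he := D.radius_pos i
  have hm := hparam.dim_pos
  have hμ := hparam.mu_pos
  have hμ1 := hparam.mu_le_one
  have hρ := hparam.rho_pos
  set t := 2 / μ₀ with ht
  have ht2 : 2 ≤ t := by
    rw [ht, le_div_iff₀ hμ]
    linarith
  have hμt : μ₀ = 2 / t := by rw [ht]; field_simp
  set w := 2 * tildeAlpha m μ₀ ρ₀ * D.radius i with hwdef
  have hwr : w / (ρ₀ * D.radius i) = 2 ^ 14 / t ^ (4 * m ^ 2 + 5 * m + 18) := by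
    rw [hwdef, tildeAlpha_eq hm hμ, ← ht,
      show 4 * m ^ 2 + 5 * m + 21 = (4 * m ^ 2 + 5 * m + 18) + 3 by ring, pow_add t _ 3, hμt]
    have : t ^ (4 * m ^ 2 + 5 * m + 18) ≠ 0 := by positivity
    generalize t ^ (4 * m ^ 2 + 5 * m + 18) = T at *
    field_simp
  have hw : 0 < w := by
    have h1 : 0 < w / (ρ₀ * D.radius i) := by rw [hwr]; positivity
    have h2 : w = w / (ρ₀ * D.radius i) * (ρ₀ * D.radius i) := by field_simp
    rw [h2]
    positivity
  have hw8 : w ≤ ρ₀ * D.radius i / 8 := by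
    have h1 : w / (ρ₀ * D.radius i) ≤ 1 / 8 := by
      rw [hwr, div_le_div_iff₀ (by positivity) (by norm_num)]
      calc (2 : ℝ) ^ 14 * 8 ≤ 2 ^ 18 := by norm_num
        _ ≤ t ^ 18 := by gcongr
        _ ≤ 1 * t ^ (4 * m ^ 2 + 5 * m + 18) := by
          rw [one_mul]
          exact pow_le_pow_right₀ (by linarith) (by omega)
    rw [div_le_iff₀ (by positivity)] at h1
    linarith
  -- With `t = 2 / μ₀`, the simplices number at most `t ^ (4 m ^ 2 + 4 m)`, since
  -- `14 / μ₀ = 7 t ≤ t ^ 4`.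
  let S := (D.finite_nearSimplices (μ₀ := μ₀) i).toFinset
  have hS : (S.card : ℝ) ≤ t ^ (4 * (m * (m + 1))) := by
    rw [← Set.ncard_eq_toFinset_card]
    refine (D.ncard_nearSimplices_le hinput hμ hμ1 i).trans ?_
    rw [pow_mul t]
    refine pow_le_pow_left₀ (by positivity) ?_ _
    rw [hμt, div_div_eq_mul_div, div_le_iff₀ (by norm_num)]
    have : 2 ^ 3 ≤ t ^ 3 := by gcongr
    nlinarith
  have hS1 : (S.card : ℝ) * (6 * 2 ^ m * (w / (ρ₀ * D.radius i))) < 1 := by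
    rw [hwr]
    calc (S.card : ℝ) * (6 * 2 ^ m * (2 ^ 14 / t ^ (4 * m ^ 2 + 5 * m + 18)))
        ≤ t ^ (4 * (m * (m + 1))) * (6 * 2 ^ m * (2 ^ 14 / t ^ (4 * m ^ 2 + 5 * m + 18))) := by
          gcongr
      _ = 6 * 2 ^ (m + 14) / t ^ (m + 18) := by
          rw [show 4 * m ^ 2 + 5 * m + 18 = 4 * (m * (m + 1)) + (m + 18) by ring, pow_add t,
            pow_add 2 m 14]
          field_simp
      _ < 1 := by
          rw [div_lt_one (by positivity)]
          calc (6 : ℝ) * 2 ^ (m + 14) < 2 ^ 4 * 2 ^ (m + 14) := by gcongr; norm_num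
            _ = 2 ^ (m + 18) := by rw [← pow_add]; congr 1; ring
            _ ≤ t ^ (m + 18) := by gcongr
  -- A simplex may be degenerate in its current position; then it has no circumcentre, and the
  -- shell around the origin that is assigned to it is harmless.
  let P : Finset (Fin n) → Prop := fun s => ∃ cR : E m × ℝ,
    IsCircumcentre (s.image fun l => D.chart i (q l)) cR.1 cR.2
  let cR : Finset (Fin n) → E m × ℝ := fun s => if hs : P s then hs.choose else (0, 0)
  have hne : ∀ s ∈ D.nearSimplices μ₀ i, (s.image fun l => D.chart i (q l)).Nonempty :=
    fun s hs => Finset.Nonempty.image (Finset.card_pos.1 (by have := hs.1; omega)) _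
  have hcR : ∀ s, P s →
      IsCircumcentre (s.image fun l => D.chart i (q l)) (cR s).1 (cR s).2 := by
    intro s hs
    simp only [cR, dif_pos hs]
    exact hs.choose_spec
  have hcR0 : ∀ s ∈ S, 0 ≤ (cR s).2 := by
    intro s hs
    by_cases hP : P s
    · exact (hcR s hP).radius_nonneg (hne s (by simpa [S] using hs))
    · simp [cR, dif_neg hP]
  obtain ⟨x, hx, hgood⟩ := exists_mem_ball_forall_lt_abs_sub hm S (D.centre i)
    (fun s => (cR s).1) (fun s => (cR s).2) hcR0 hw hw8 hS1
  refine ⟨x, hx, ?_⟩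
  rintro ⟨s, hs, c, R, hc, hd⟩
  have hc' : IsCircumcentre (s.image fun l => D.chart i (q l)) c R := by convert hc
  have hP : P s := ⟨(c, R), hc'⟩
  obtain ⟨hc1, hR1⟩ := (hcR s hP).unique (hne s hs) hc'
  have h1 := hgood s (by simpa [S] using hs)
  rw [hc1, hR1] at h1
  have h2 := abs_dist_sub_le_infDist_sphere hm x c (hc'.radius_nonneg (hne s hs))
  exact absurd (h1.trans_le h2) (not_lt.2 hd)

end Input

/-! ### Termination -/

section Trials

variable {m : ℕ}

theorem uniformBall_pos {V : Set (E m)} (hV : IsOpen V) (h : (V ∩ ball 0 1).Nonempty) :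
    0 < uniformBall m V := by
  rw [uniformBall, ProbabilityTheory.cond_apply isClosed_closedBall.measurableSet]
  refine ENNReal.mul_pos (ENNReal.inv_ne_zero.2 measure_closedBall_lt_top.ne) ?_
  have h1 : 0 < (volume : Measure (E m)) (V ∩ ball 0 1) := (hV.inter isOpen_ball).measure_pos
    volume h
  refine (h1.trans_le (measure_mono ?_)).ne'
  rw [Set.inter_comm]
  exact Set.inter_subset_inter_left _ ball_subset_closedBall

theorem trialLaw_setOf_forall_notMem {V : Set (E m)} (hV : IsOpen V)
    (h : (V ∩ ball 0 1).Nonempty) (t₀ : ℕ) :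
    trialLaw m {ω | ∀ t ≥ t₀, ω t ∉ V} = 0 := by
  have hlt : uniformBall m Vᶜ < 1 := by
    rw [prob_compl_eq_one_sub hV.measurableSet]
    exact ENNReal.sub_lt_self ENNReal.one_ne_top one_ne_zero (uniformBall_pos hV h).ne'
  have hle : ∀ N : ℕ, trialLaw m {ω | ∀ t ≥ t₀, ω t ∉ V} ≤ uniformBall m Vᶜ ^ N := by
    intro N
    have h1 : trialLaw m (Set.pi (Finset.Ico t₀ (t₀ + N) : Set ℕ) fun _ => Vᶜ) =
        uniformBall m Vᶜ ^ N := by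
      rw [trialLaw, Measure.infinitePi_pi _ fun _ _ => hV.measurableSet.compl, Finset.prod_const,
        Nat.card_Ico, Nat.add_sub_cancel_left]
    rw [← h1]
    refine measure_mono fun ω hω t ht => hω t ?_
    exact (Finset.mem_Ico.1 (Finset.mem_coe.1 ht)).1
  exact le_antisymm (ge_of_tendsto' (ENNReal.tendsto_pow_atTop_nhds_zero_of_lt_one hlt) hle)
    zero_le

end Trials

namespace Input

variable {m n : ℕ} {M : Type*} [TopologicalSpace M] (D : Input m n M) {μ₀ ε₀ ξ₀ ρ₀ : ℝ}

/-- The successful trials for the label `i` when the current positions are `q`. -/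
def goodTrials (μ₀ ρ₀ : ℝ) (q : Fin n → M) (i : Fin n) : Set (E m) :=
  {u | D.IsGoodPerturbation μ₀ ρ₀ q i (D.centre i + (ρ₀ * D.radius i) • u)}

theorem isOpen_goodTrials (q : Fin n → M) (i : Fin n) : IsOpen (D.goodTrials μ₀ ρ₀ q i) :=
  (D.isOpen_setOf_isGoodPerturbation q i).preimage
    (f := fun u => D.centre i + (ρ₀ * D.radius i) • u) (by fun_prop)

theorem exists_mem_goodTrials (hinput : D.InputAssumptions μ₀ ε₀ ξ₀)
    (hparam : ParameterConstraints m μ₀ ε₀ ξ₀ ρ₀) (q : Fin n → M) (i : Fin n) :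
    ∃ u ∈ D.goodTrials μ₀ ρ₀ q i, u ∈ ball 0 1 := by
  obtain ⟨x, hx, hgood⟩ := D.exists_isGoodPerturbation hinput hparam q i
  have hr : 0 < ρ₀ * D.radius i := mul_pos hparam.rho_pos (D.radius_pos i)
  refine ⟨(ρ₀ * D.radius i)⁻¹ • (x - D.centre i), ?_, ?_⟩
  · rw [goodTrials, Set.mem_ofPred_eq, smul_inv_smul₀ hr.ne', add_sub_cancel]
    exact hgood
  · rw [mem_ball_zero_iff, norm_smul, ← dist_eq_norm, norm_inv, Real.norm_eq_abs, abs_of_pos hr,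
      inv_mul_lt_one₀ hr]
    exact hx

theorem step_of_mem {u : E m} {s : ℕ × (Fin n → M)} (h : s.1 < n)
    (hu : u ∈ D.goodTrials μ₀ ρ₀ s.2 ⟨s.1, h⟩) :
    D.step μ₀ ρ₀ u s = (s.1 + 1, Function.update s.2 ⟨s.1, h⟩
      ((D.chart ⟨s.1, h⟩).symm (D.centre ⟨s.1, h⟩ + (ρ₀ * D.radius ⟨s.1, h⟩) • u))) := by
  rw [step, dif_pos h]
  exact if_pos hu

theorem step_eq_self {u : E m} {s : ℕ × (Fin n → M)}
    (hu : ∀ h : s.1 < n, u ∉ D.goodTrials μ₀ ρ₀ s.2 ⟨s.1, h⟩) : D.step μ₀ ρ₀ u s = s := by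
  rw [step]
  by_cases h : s.1 < n
  · rw [dif_pos h]
    exact if_neg (hu h)
  · rw [dif_neg h]

theorem run_succ (ω : ℕ → E m) (t : ℕ) :
    D.run μ₀ ρ₀ ω (t + 1) = D.step μ₀ ρ₀ (ω t) (D.run μ₀ ρ₀ ω t) := rfl

theorem run_fst_le (ω : ℕ → E m) (t : ℕ) : (D.run μ₀ ρ₀ ω t).1 ≤ n := by
  induction t with
  | zero => exact Nat.zero_le n
  | succ t ih =>
    rw [run_succ]
    by_cases h : ∃ h : (D.run μ₀ ρ₀ ω t).1 < n,
        ω t ∈ D.goodTrials μ₀ ρ₀ (D.run μ₀ ρ₀ ω t).2 ⟨_, h⟩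
    · obtain ⟨h, hu⟩ := h
      rw [D.step_of_mem h hu]
      exact h
    · rw [D.step_eq_self fun h' hu => h ⟨h', hu⟩]
      exact ih

/-- A run that does not terminate is eventually stuck in one state. -/
theorem exists_forall_notMem_goodTrials {ω : ℕ → E m} (h : ∀ t, ¬ D.TerminatedAt μ₀ ρ₀ ω t) :
    ∃ (t₀ : ℕ) (q : Fin n → M) (i : Fin n), ∀ t ≥ t₀, ω t ∉ D.goodTrials μ₀ ρ₀ q i := by
  have hlt : ∀ t, (D.run μ₀ ρ₀ ω t).1 < n := fun t => lt_of_le_of_ne (D.run_fst_le ω t) (h t)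
  have hbdd : BddAbove (Set.range fun t => (D.run μ₀ ρ₀ ω t).1) :=
    ⟨n, by rintro _ ⟨t, rfl⟩; exact D.run_fst_le ω t⟩
  obtain ⟨t₀, ht₀⟩ := Nat.sSup_mem (Set.range_nonempty _) hbdd
  have hmax : ∀ t, (D.run μ₀ ρ₀ ω t).1 ≤ (D.run μ₀ ρ₀ ω t₀).1 := fun t =>
    (le_csSup hbdd ⟨t, rfl⟩).trans ht₀.ge
  have hstuck : ∀ t, D.run μ₀ ρ₀ ω t = D.run μ₀ ρ₀ ω t₀ →
      ω t ∉ D.goodTrials μ₀ ρ₀ (D.run μ₀ ρ₀ ω t₀).2 ⟨_, hlt t₀⟩ := by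
    intro t ht hu
    have h1 := hmax (t + 1)
    rw [run_succ, ht, D.step_of_mem (hlt t₀) hu] at h1
    exact absurd h1 (by simp)
  refine ⟨t₀, (D.run μ₀ ρ₀ ω t₀).2, ⟨_, hlt t₀⟩, fun t ht => hstuck t ?_⟩
  induction t, ht using Nat.le_induction with
  | base => rfl
  | succ t _ ih =>
    rw [run_succ, ih]
    exact D.step_eq_self fun _ => hstuck t ih

/-- The algorithm terminates almost surely. Every set of successful trials contains a member of a
countable basis that meets the open unit ball, and almost every sequence of trials visits all these
basis sets infinitely often; thus no measurability of the run is needed. -/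
theorem ae_exists_terminatedAt (hinput : D.InputAssumptions μ₀ ε₀ ξ₀)
    (hparam : ParameterConstraints m μ₀ ε₀ ξ₀ ρ₀) :
    ∀ᵐ ω ∂trialLaw m, ∃ t, D.TerminatedAt μ₀ ρ₀ ω t := by
  let B := TopologicalSpace.countableBasis (E m)
  have hB := TopologicalSpace.isBasis_countableBasis (E m)
  have hnull : trialLaw m (⋃ V ∈ {V ∈ B | (V ∩ ball 0 1).Nonempty}, ⋃ t₀ : ℕ,
      {ω | ∀ t ≥ t₀, ω t ∉ V}) = 0 := by
    rw [measure_biUnion_null_iff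
      ((TopologicalSpace.countable_countableBasis (E m)).mono fun V hV => hV.1)]
    intro V hV
    exact measure_iUnion_null fun t₀ => trialLaw_setOf_forall_notMem (hB.isOpen hV.1) hV.2 t₀
  rw [ae_iff]
  refine measure_mono_null (fun ω hω => ?_) hnull
  obtain ⟨t₀, q, i, hq⟩ := D.exists_forall_notMem_goodTrials fun t ht => hω ⟨t, ht⟩
  obtain ⟨u, hu, hu1⟩ := D.exists_mem_goodTrials hinput hparam q i
  obtain ⟨V, hVB, huV, hVsub⟩ := hB.exists_subset_of_mem_open hu (D.isOpen_goodTrials q i)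
  simp only [Set.mem_iUnion]
  exact ⟨V, ⟨hVB, u, huV, hu1⟩, t₀, fun t ht hV => hq t ht (hVsub hV)⟩

/-! ### The states of the algorithm -/

/-- The positions of the points when the label `i` is processed, in a run with output `q`. -/
def stage (q : Fin n → M) (i : Fin n) : Fin n → M := fun l => if l < i then q l else D.pt l

/-- The point with label `l` has been processed with the output positions `q`: it has been moved
within the ball of allowed perturbations, and the move was a good perturbation when it was made. -/
def IsProcessed (μ₀ ρ₀ : ℝ) (q : Fin n → M) (l : Fin n) : Prop :=
  ∃ x ∈ closedBall (D.centre l) (ρ₀ * D.radius l), q l = (D.chart l).symm x ∧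
    D.IsGoodPerturbation μ₀ ρ₀ (D.stage q l) l x

theorem stage_congr {q q' : Fin n → M} {i : Fin n} (h : ∀ l < i, q l = q' l) :
    D.stage q i = D.stage q' i := by
  funext l
  by_cases hl : l < i
  · simp [stage, hl, h l hl]
  · simp [stage, hl]

theorem run_invariant (hρ : 0 ≤ ρ₀) {ω : ℕ → E m} (hω : ∀ t, ω t ∈ closedBall 0 1) (t : ℕ) :
    (∀ l : Fin n, (D.run μ₀ ρ₀ ω t).1 ≤ l → (D.run μ₀ ρ₀ ω t).2 l = D.pt l) ∧
      ∀ l : Fin n, (l : ℕ) < (D.run μ₀ ρ₀ ω t).1 →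
        D.IsProcessed μ₀ ρ₀ (D.run μ₀ ρ₀ ω t).2 l := by
  induction t with
  | zero => exact ⟨fun l _ => rfl, fun l hl => absurd hl (Nat.not_lt_zero _)⟩
  | succ t ih =>
    rw [run_succ]
    by_cases h : ∃ h : (D.run μ₀ ρ₀ ω t).1 < n,
        ω t ∈ D.goodTrials μ₀ ρ₀ (D.run μ₀ ρ₀ ω t).2 ⟨_, h⟩
    · obtain ⟨h, hu⟩ := h
      rw [D.step_of_mem h hu]
      generalize D.run μ₀ ρ₀ ω t = s at *
      obtain ⟨a, q⟩ := s
      simp only at h hu ih ⊢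
      have hne : ∀ {y : M} {l : Fin n}, (l : ℕ) ≠ a → Function.update q ⟨a, h⟩ y l = q l :=
        fun hl => Function.update_of_ne (fun h => hl (congrArg Fin.val h)) _ _
      refine ⟨fun l hl => ?_, fun l hl => ?_⟩
      · rw [hne (by omega)]
        exact ih.1 l (by omega)
      · rcases eq_or_ne (l : ℕ) a with hla | hla
        · obtain rfl : l = ⟨a, h⟩ := Fin.ext hla
          refine ⟨_, ?_, Function.update_self _ _ _, ?_⟩
          · rw [mem_closedBall, dist_self_add_left, norm_smul, Real.norm_eq_abs,
              abs_of_nonneg (mul_nonneg hρ (D.radius_pos _).le)]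
            exact mul_le_of_le_one_right (mul_nonneg hρ (D.radius_pos _).le)
              (mem_closedBall_zero_iff.1 (hω t))
          · have hst : D.stage (Function.update q ⟨a, h⟩ ((D.chart ⟨a, h⟩).symm
                (D.centre ⟨a, h⟩ + (ρ₀ * D.radius ⟨a, h⟩) • ω t))) ⟨a, h⟩ = q := by
              funext k
              by_cases hk : k < ⟨a, h⟩
              · have : (k : ℕ) < a := hk
                rw [stage, if_pos hk, hne this.ne]
              · have : a ≤ (k : ℕ) := not_lt.1 hk
                rw [stage, if_neg hk, ih.1 k this]
            rw [hst]
            exact hu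
        · obtain ⟨x, hx, hqx, hgood⟩ := ih.2 l (by omega)
          refine ⟨x, hx, by rw [hne hla, hqx], ?_⟩
          rw [D.stage_congr (q' := q)]
          · exact hgood
          · intro k hk
            have : (k : ℕ) < l := hk
            exact hne (by omega)
    · rw [D.step_eq_self fun h' hu => h ⟨h', hu⟩]
      exact ih

/-- When the run has terminated, every label has been processed. -/
theorem isProcessed_output (hρ : 0 ≤ ρ₀) {ω : ℕ → E m} (hω : ∀ t, ω t ∈ closedBall 0 1) {t : ℕ}
    (ht : D.TerminatedAt μ₀ ρ₀ ω t) (l : Fin n) :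
    D.IsProcessed μ₀ ρ₀ (D.output μ₀ ρ₀ ω t) l :=
  (D.run_invariant hρ hω t).2 l (by
    have : (D.run μ₀ ρ₀ ω t).1 = n := ht
    rw [this]
    exact l.2)

end Input

/-! ### Transport of perturbed points between charts -/

namespace Input

variable {m n : ℕ} {M : Type*} [TopologicalSpace M] {D : Input m n M} {μ₀ ε₀ ξ₀ ρ₀ : ℝ}

theorem InputAssumptions.abs_dist_sub_dist_le (hinput : D.InputAssumptions μ₀ ε₀ ξ₀)
    {i j : Fin n} {a b : M} (hai : a ∈ (D.chart i).source) (haj : a ∈ (D.chart j).source)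
    (hbi : b ∈ (D.chart i).source) (hbj : b ∈ (D.chart j).source) :
    |dist (D.chart i a) (D.chart i b) - dist (D.chart j a) (D.chart j b)| ≤
      ξ₀ * dist (D.chart i a) (D.chart i b) := by
  have h : ∀ {a : M}, a ∈ (D.chart i).source → a ∈ (D.chart j).source →
      D.chart i a ∈ (D.transition i j).source ∧
        D.transition i j (D.chart i a) = D.chart j a := by
    intro a hai haj
    refine ⟨?_, ?_⟩
    · rw [transition, OpenPartialHomeomorph.trans_source]
      refine ⟨(D.chart i).map_source hai, ?_⟩
      rwa [Set.mem_preimage, (D.chart i).left_inv hai]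
    · rw [transition, OpenPartialHomeomorph.trans_apply, (D.chart i).left_inv hai]
  have h1 := hinput.distortion i j _ (h hai haj).1 _ (h hbi hbj).1
  rwa [(h hai haj).2, (h hbi hbj).2] at h1

theorem InputAssumptions.dist_le (hinput : D.InputAssumptions μ₀ ε₀ ξ₀)
    {i j : Fin n} {a b : M} (hai : a ∈ (D.chart i).source) (haj : a ∈ (D.chart j).source)
    (hbi : b ∈ (D.chart i).source) (hbj : b ∈ (D.chart j).source) :
    dist (D.chart j a) (D.chart j b) ≤ (1 + ξ₀) * dist (D.chart i a) (D.chart i b) := by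
  have := (abs_le.1 (hinput.abs_dist_sub_dist_le hai haj hbi hbj)).1
  linarith

/-- A point that is joined to a point `a` of a chart domain by a short segment in another chart
lies in that chart domain as well. This is where `M` has to be a Hausdorff space: the closed ball
in the patch is the image of a closed subset of `M`, so that the segment cannot leave the chart
domain without leaving the ball first. -/
theorem InputAssumptions.mem_source [T2Space M] (hinput : D.InputAssumptions μ₀ ε₀ ξ₀)
    (hξ : 0 ≤ ξ₀) {i j : Fin n} {a b : M} (hai : a ∈ (D.chart i).source)
    (haj : a ∈ (D.chart j).source) (hbi : b ∈ (D.chart i).source)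
    (hseg : segment ℝ (D.chart i a) (D.chart i b) ⊆ D.patch i) {r : ℝ}
    (hr : (1 + ξ₀) * dist (D.chart i a) (D.chart i b) ≤ r)
    (hball : closedBall (D.chart j a) r ⊆ D.patch j) : b ∈ (D.chart j).source := by
  set K := (D.chart j).symm '' closedBall (D.chart j a) r with hK
  have hKc : IsClosed K :=
    ((isCompact_closedBall _ _).image_of_continuousOn
      ((D.chart j).continuousOn_symm.mono hball)).isClosed
  set S := (D.chart i).symm '' segment ℝ (D.chart i a) (D.chart i b) with hS
  have hSc : IsPreconnected S :=
    (convex_segment _ _).isPreconnected.image _ ((D.chart i).continuousOn_symm.mono hseg)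
  have haS : a ∈ S := ⟨D.chart i a, left_mem_segment ℝ _ _, (D.chart i).left_inv hai⟩
  have hbS : b ∈ S := ⟨D.chart i b, right_mem_segment ℝ _ _, (D.chart i).left_inv hbi⟩
  have hKsub : K ⊆ (D.chart j).source := by
    rintro _ ⟨y, hy, rfl⟩
    exact (D.chart j).map_target (hball hy)
  have hsub : ∀ y ∈ S, y ∈ (D.chart j).source → y ∈ K := by
    rintro _ ⟨y, hy, rfl⟩ hyj
    have hyi := (D.chart i).map_target (hseg hy)
    refine ⟨D.chart j ((D.chart i).symm y), ?_, (D.chart j).left_inv hyj⟩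
    have h1 := hinput.dist_le hai haj hyi hyj
    rw [(D.chart i).right_inv (hseg hy)] at h1
    have h2 : dist (D.chart i a) y ≤ dist (D.chart i a) (D.chart i b) := by
      have := dist_add_dist_of_mem_segment hy
      linarith [dist_nonneg (x := y) (y := D.chart i b)]
    rw [mem_closedBall, dist_comm]
    refine h1.trans (le_trans ?_ hr)
    gcongr
  by_contra hb
  obtain ⟨y, hyS, hyj, hyK⟩ := hSc _ _ (D.chart j).open_source hKc.isOpen_compl
    (fun y hy => by
      by_cases hyj : y ∈ (D.chart j).source
      · exact Or.inl hyj
      · exact Or.inr fun hyK => hyj (hKsub hyK))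
    ⟨a, haS, haj⟩ ⟨b, hbS, fun hbK => hb (hKsub hbK)⟩
  exact hyK (hsub y hyS hyj)

/-- Every point is moved by at most `ρ₀ εᵢ` in its own chart. -/
def IsPerturbation (D : Input m n M) (ρ₀ : ℝ) (q : Fin n → M) : Prop :=
  ∀ l, q l ∈ (D.chart l).source ∧ dist (D.chart l (q l)) (D.centre l) ≤ ρ₀ * D.radius l

theorem InputAssumptions.radius_le (hinput : D.InputAssumptions μ₀ ε₀ ξ₀) (hε : 0 ≤ ε₀)
    {i j : Fin n} (hj : j ∈ D.nbrs i) (hd : dist (D.coord i j) (D.centre i) < 8 * D.radius i) :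
    D.radius i ≤ (1 + ε₀) * D.radius j ∧ D.radius j ≤ (1 + ε₀) * D.radius i := by
  have h1 := abs_le.1 (hinput.adaptive i j hj hd)
  have h2 : ε₀ * min (D.radius i) (D.radius j) ≤ ε₀ * D.radius i :=
    mul_le_mul_of_nonneg_left (min_le_left _ _) hε
  have h3 : ε₀ * min (D.radius i) (D.radius j) ≤ ε₀ * D.radius j :=
    mul_le_mul_of_nonneg_left (min_le_right _ _) hε
  constructor <;> linarith [h1.1, h1.2]

section

variable [T2Space M] (hinput : D.InputAssumptions μ₀ ε₀ ξ₀)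
  (hparam : ParameterConstraints m μ₀ ε₀ ξ₀ ρ₀)

include hinput hparam

theorem IsPerturbation.mem_source {q : Fin n → M} (hq : D.IsPerturbation ρ₀ q) {i l : Fin n}
    (hl : l ∈ D.nbrs i) (hd : dist (D.coord i l) (D.centre i) < 7 * D.radius i) :
    q l ∈ (D.chart i).source ∧
      dist (D.chart i (q l)) (D.coord i l) ≤ tildeRho ε₀ ξ₀ ρ₀ * D.radius i := by
  have he := D.radius_pos i
  have hel := D.radius_pos l
  have hρ := hparam.rho_pos
  have hρμ := hparam.rho_le
  have hρρ := hparam.rho_le_tildeRho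
  have hμ1 := hparam.mu_le_one
  have hrad := (hinput.radius_le hparam.eps_nonneg hl (by linarith)).2
  obtain ⟨hql, hqd⟩ := hq l
  have hbound : (1 + ξ₀) * dist (D.chart l (D.pt l)) (D.chart l (q l)) ≤
      tildeRho ε₀ ξ₀ ρ₀ * D.radius i := by
    rw [dist_comm]
    calc (1 + ξ₀) * dist (D.chart l (q l)) (D.centre l)
        ≤ (1 + ξ₀) * (ρ₀ * ((1 + ε₀) * D.radius i)) := by
          have := hparam.xi_nonneg
          gcongr
          exact hqd.trans (by gcongr)
      _ = _ := by rw [tildeRho]; ring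
  have hball : ball (D.centre l) (8 * D.radius l) ⊆ D.patch l := hinput.ball_subset l
  have hmem : q l ∈ (D.chart i).source := by
    refine hinput.mem_source hparam.xi_nonneg (D.pt_mem l) hl hql ?_ hbound ?_
    · refine ((convex_ball _ _).segment_subset (mem_ball_self (by linarith)) ?_).trans hball
      change dist _ (D.centre l) < _
      nlinarith
    · refine (closedBall_subset_ball' ?_).trans (hinput.ball_subset i)
      change _ + dist (D.coord i l) _ < _
      nlinarith
  refine ⟨hmem, ?_⟩
  rw [dist_comm]
  exact (hinput.dist_le (D.pt_mem l) hl hql hmem).trans hbound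

/-- If the perturbed position of a point is in the region of interest, then so was, nearly, its
initial position. The sampling radius of that point is not under control a priori; it is bounded by
comparing both sampling radii with that of a sample point close to the perturbed position. -/
theorem IsPerturbation.mem_nbrs {q : Fin n → M} (hq : D.IsPerturbation ρ₀ q) {i l : Fin n}
    (hl : q l ∈ (D.chart i).source)
    (hd : dist (D.chart i (q l)) (D.centre i) < 6 * D.radius i) :
    l ∈ D.nbrs i ∧
      dist (D.chart i (q l)) (D.coord i l) ≤ tildeRho ε₀ ξ₀ ρ₀ * D.radius i := by
  have he := D.radius_pos i
  have hel := D.radius_pos l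
  have hρ := hparam.rho_pos
  have hρμ := hparam.rho_le
  have hρρ := hparam.rho_le_tildeRho
  have hμ1 := hparam.mu_le_one
  have hε1 := hparam.eps_le_one
  have hξ := hparam.xi_nonneg
  have hε := hparam.eps_nonneg
  have hξ1 : 1 + ξ₀ ≤ 2 := by nlinarith [hparam.one_add_mul_one_add_le]
  obtain ⟨hql, hqd⟩ := hq l
  -- If `D.radius l` is the larger one, a sample point close to `q l` in the patch of `i` is also
  -- found in the patch of `l`, and adaptivity applies in both patches.
  have hrad : D.radius l ≤ 4 * D.radius i := by
    rcases lt_or_ge (D.radius l) (D.radius i) with hlt | hge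
    · linarith
    obtain ⟨_, ⟨j, hj, rfl⟩, hjd⟩ := (hinput.net i).dense (D.chart i (q l))
      (mem_ball.2 (by linarith))
    have hjc : dist (D.coord i j) (D.centre i) < 8 * D.radius i := by
      linarith [dist_triangle_left (D.coord i j) (D.centre i) (D.chart i (q l))]
    have h2 : (1 + ξ₀) * dist (D.chart i (q l)) (D.chart i (D.pt j)) ≤ 2 * D.radius i := by
      have : dist (D.chart i (q l)) (D.chart i (D.pt j)) < D.radius i := hjd
      gcongr
    have hjl : D.pt j ∈ (D.chart l).source := by
      refine hinput.mem_source hξ hl hql hj ?_ h2 ?_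
      · refine ((convex_ball (D.centre i) (8 * D.radius i)).segment_subset ?_ ?_).trans
          (hinput.ball_subset i)
        · exact mem_ball.2 (by linarith)
        · exact mem_ball.2 hjc
      · refine (closedBall_subset_ball' ?_).trans (hinput.ball_subset l)
        nlinarith
    have h3 := hinput.dist_le hl hql hj hjl
    have h4 : dist (D.coord l j) (D.centre l) < 8 * D.radius l := by
      have h5 := dist_triangle_left (D.coord l j) (D.centre l) (D.chart l (q l))
      have h6 : dist (D.chart l (q l)) (D.coord l j) ≤ 2 * D.radius i := h3.trans h2
      nlinarith
    have h5 := (hinput.radius_le hε hjl h4).1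
    have h6 := (hinput.radius_le hε hj hjc).2
    have h7 := D.radius_pos j
    nlinarith
  have hbound : (1 + ξ₀) * dist (D.chart l (q l)) (D.centre l) ≤ D.radius i := by
    calc (1 + ξ₀) * dist (D.chart l (q l)) (D.centre l)
        ≤ (1 + ξ₀) * (ρ₀ * (4 * D.radius i)) := by
          gcongr
          exact hqd.trans (by gcongr)
      _ = 4 * ((1 + ξ₀) * ρ₀) * D.radius i := by ring
      _ ≤ 1 * D.radius i := by
          gcongr
          linarith [hparam.one_add_xi_mul_rho_le]
      _ = _ := one_mul _
  have hmem : D.pt l ∈ (D.chart i).source := by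
    refine hinput.mem_source hξ hql hl (D.pt_mem l) ?_ hbound ?_
    · refine ((convex_ball (D.centre l) (8 * D.radius l)).segment_subset ?_
        (mem_ball_self (by linarith))).trans (hinput.ball_subset l)
      rw [mem_ball]
      nlinarith
    · refine (closedBall_subset_ball' ?_).trans (hinput.ball_subset i)
      linarith
  have hdist := hinput.dist_le hql hl (D.pt_mem l) hmem
  have h1 : dist (D.coord i l) (D.centre i) < 8 * D.radius i := by
    have h2 := dist_triangle_left (D.coord i l) (D.centre i) (D.chart i (q l))
    have h3 : dist (D.chart i (q l)) (D.coord i l) ≤ D.radius i := hdist.trans hbound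
    linarith
  have hrad' := (hinput.radius_le hε hmem h1).2
  refine ⟨hmem, hdist.trans ?_⟩
  calc (1 + ξ₀) * dist (D.chart l (q l)) (D.centre l)
      ≤ (1 + ξ₀) * (ρ₀ * ((1 + ε₀) * D.radius i)) := by
        gcongr
        exact hqd.trans (by gcongr)
    _ = _ := by rw [tildeRho]; ring

/-! ### The perturbed points form a net -/

theorem IsPerturbation.le_dist {q : Fin n → M} (hq : D.IsPerturbation ρ₀ q) {i : Fin n} :
    ∀ x ∈ D.region q i, ∀ y ∈ D.region q i, x ≠ y →
      (μ₀ - 2 * tildeRho ε₀ ξ₀ ρ₀) * D.radius i ≤ dist x y := by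
  rintro _ ⟨⟨_, ⟨⟨l, rfl⟩, hl⟩, rfl⟩, hld⟩ _ ⟨⟨_, ⟨⟨k, rfl⟩, hk⟩, rfl⟩, hkd⟩ hne
  obtain ⟨hl1, hl2⟩ := hq.mem_nbrs hinput hparam hl hld
  obtain ⟨hk1, hk2⟩ := hq.mem_nbrs hinput hparam hk hkd
  have hlk : D.coord i l ≠ D.coord i k := by
    intro h
    rw [D.coord_injOn i hl1 hk1 h] at hne
    exact hne rfl
  have h1 := (hinput.net i).separated _ ⟨l, hl1, rfl⟩ _ ⟨k, hk1, rfl⟩ hlk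
  have h2 := dist_triangle4 (D.coord i l) (D.chart i (q l)) (D.chart i (q k)) (D.coord i k)
  rw [dist_comm (D.coord i l) (D.chart i (q l))] at h2
  linarith

theorem IsPerturbation.isNet {q : Fin n → M} (hq : D.IsPerturbation ρ₀ q) (i : Fin n) :
    IsNet ((μ₀ - 2 * tildeRho ε₀ ξ₀ ρ₀) / (1 + tildeRho ε₀ ξ₀ ρ₀))
      ((1 + tildeRho ε₀ ξ₀ ρ₀) * D.radius i) (D.region q i)
      (closedBall (D.centre i) (6 * D.radius i - (1 + tildeRho ε₀ ξ₀ ρ₀) * D.radius i)) := by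
  have hρ := hparam.tildeRho_pos
  have he := D.radius_pos i
  refine ⟨fun x hx y hy hxy => ?_, fun x hx => ?_⟩
  · rw [← mul_assoc, div_mul_cancel₀ _ (by linarith)]
    exact hq.le_dist hinput hparam x hx y hy hxy
  · rw [mem_closedBall] at hx
    have hρe : 0 < tildeRho ε₀ ξ₀ ρ₀ * D.radius i := mul_pos hρ he
    obtain ⟨_, ⟨l, hl, rfl⟩, hld⟩ := (hinput.net i).dense x (mem_ball.2 (by linarith))
    have h1 := dist_triangle_left (D.coord i l) (D.centre i) x
    obtain ⟨hmem, hd⟩ := hq.mem_source hinput hparam hl (by linarith)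
    have h2 : dist x (D.chart i (q l)) < (1 + tildeRho ε₀ ξ₀ ρ₀) * D.radius i := by
      linarith [dist_triangle_right x (D.chart i (q l)) (D.coord i l)]
    refine ⟨_, ⟨⟨q l, ⟨⟨l, rfl⟩, hmem⟩, rfl⟩, ?_⟩, h2⟩
    rw [mem_ball]
    linarith [dist_triangle_left (D.chart i (q l)) (D.centre i) x]

end

end Input

/-! ### Nearly cospherical simplices under a small distortion -/

section Distortion

variable {m : ℕ}

theorem abs_sq_sub_sq_le {a b ξ r : ℝ} (ha : 0 ≤ a) (hb : 0 ≤ b) (hξ : 0 ≤ ξ) (hξ1 : ξ ≤ 1)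
    (har : a ≤ r) (h : |a - b| ≤ ξ * a) : |a ^ 2 - b ^ 2| ≤ 3 * ξ * r ^ 2 := by
  have h1 : a + b ≤ 3 * a := by nlinarith [(abs_le.1 h).1]
  rw [show a ^ 2 - b ^ 2 = (a - b) * (a + b) by ring, abs_mul, abs_of_nonneg (add_nonneg ha hb)]
  calc |a - b| * (a + b) ≤ (ξ * a) * (3 * a) := by gcongr
    _ = 3 * ξ * a ^ 2 := by ring
    _ ≤ 3 * ξ * r ^ 2 := by gcongr

/-- The points `p l`, `l ∈ T`, are affinely independent. This form of `AffineIndependent` for a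
finite set of labels is convenient for enlarging that set. -/
def AffinelyFree {ι V : Type*} [AddCommGroup V] [Module ℝ V] (T : Finset ι) (p : ι → V) : Prop :=
  ∀ w : ι → ℝ, ∑ l ∈ T, w l = 0 → ∑ l ∈ T, w l • p l = 0 → ∀ l ∈ T, w l = 0

theorem AffinelyFree.affineIndependent {ι V : Type*} [AddCommGroup V] [Module ℝ V]
    {T : Finset ι} {p : ι → V} (h : AffinelyFree T p) :
    AffineIndependent ℝ fun l : T => p l := by
  classical
  rw [affineIndependent_iff_of_fintype]
  intro w hw hsum ⟨l, hl⟩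
  rw [Finset.weightedVSub_eq_linear_combination _ hw] at hsum
  have h1 := h (fun v => if hv : v ∈ T then w ⟨v, hv⟩ else 0) ?_ ?_ l hl
  · simpa [hl] using h1
  · rw [← Finset.sum_coe_sort, ← hw]
    exact Finset.sum_congr rfl fun v _ => by simp
  · rw [← Finset.sum_coe_sort, ← hsum]
    exact Finset.sum_congr rfl fun v _ => by simp

theorem AffinelyFree.insert {ι V : Type*} [NormedAddCommGroup V] [InnerProductSpace ℝ V]
    [DecidableEq ι] {T : Finset ι} {p : ι → V} (h : AffinelyFree T p) {a : ι} (haT : a ∉ T)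
    (ha : p a ∉ affineSpan ℝ (p '' T)) : AffinelyFree (insert a T) p := by
  intro w hw hsum
  rw [Finset.sum_insert haT] at hw hsum
  have hwa : w a = 0 := by
    by_contra h0
    refine ha ?_
    have h1 : ∑ l ∈ T, -(w l / w a) = 1 := by
      rw [Finset.sum_neg_distrib, ← Finset.sum_div]
      field_simp
      linarith
    have h2 : p a = ∑ l ∈ T, -(w l / w a) • p l := by
      rw [← inv_smul_smul₀ h0 (p a), eq_neg_of_add_eq_zero_left hsum, smul_neg, Finset.smul_sum,
        ← Finset.sum_neg_distrib]
      refine Finset.sum_congr rfl fun l _ => ?_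
      rw [neg_smul, smul_smul, div_eq_inv_mul]
    rw [h2]
    exact sum_smul_mem_affineSpan_image h1 p
  rw [hwa, zero_add] at hw
  rw [hwa, zero_smul, zero_add] at hsum
  intro l hl
  rcases Finset.mem_insert.1 hl with rfl | hl
  · exact hwa
  · exact h w hw hsum l hl

theorem exists_isCircumcentre (hm : 1 ≤ m) {ι : Type*} [DecidableEq (E m)] {T : Finset ι}
    {p : ι → E m} (h : AffinelyFree T p) (hT : T.card = m + 1) :
    ∃ (c : E m) (R : ℝ), 0 ≤ R ∧ IsCircumcentre (T.image p) c R := by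
  have hai := h.affineIndependent
  have hTne : T.Nonempty := Finset.card_pos.1 (by omega)
  have : Nonempty T := hTne.to_subtype
  have htop : affineSpan ℝ (Set.range fun l : T => p l) = ⊤ := by
    rw [hai.affineSpan_eq_top_iff_card_eq_finrank_add_one]
    simp [hT]
  obtain ⟨S, ⟨-, hS⟩, huniq⟩ := hai.existsUnique_dist_eq
  have hS' : IsCircumscribing (T.image p) S.center S.radius := by
    intro v hv
    obtain ⟨l, hl, rfl⟩ := Finset.mem_image.1 hv
    exact hS ⟨⟨l, hl⟩, rfl⟩
  refine ⟨S.center, S.radius, ?_, hS', fun c' R' h' => ?_⟩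
  · obtain ⟨l, hl⟩ := hTne
    rw [← hS' (p l) (Finset.mem_image_of_mem p hl)]
    exact dist_nonneg
  · have h1 := huniq ⟨c', R'⟩ ⟨by rw [htop]; trivial, ?_⟩
    · rw [← h1]
    · rintro _ ⟨⟨l, hl⟩, rfl⟩
      exact h' (p l) (Finset.mem_image_of_mem p hl)

/-- There are points at any given distance from `p` that have at least this distance from a given
proper affine subspace. -/
theorem exists_dist_eq_forall_le_dist {V : Type*} [NormedAddCommGroup V] [InnerProductSpace ℝ V]
    [FiniteDimensional ℝ V] {A : AffineSubspace ℝ V} (hA : A.direction ≠ ⊤) (p : V) {t : ℝ}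
    (ht : 0 ≤ t) : ∃ y, dist y p = t ∧ ∀ b ∈ A, t ≤ dist y b := by
  have h1 : A.directionᗮ ≠ ⊥ := fun h => hA (Submodule.orthogonal_eq_bot_iff.1 h)
  obtain ⟨v, hv, hv0⟩ := Submodule.exists_mem_ne_zero_of_ne_bot h1
  rcases (A : Set V).eq_empty_or_nonempty with hAe | ⟨b₀, hb₀⟩
  · refine ⟨p + (t * ‖v‖⁻¹) • v, ?_, fun b hb => ?_⟩
    · rw [dist_self_add_left, norm_smul, Real.norm_eq_abs, abs_of_nonneg (by positivity), mul_assoc,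
        inv_mul_cancel₀ (norm_ne_zero_iff.2 hv0), mul_one]
    · exact absurd (show b ∈ (A : Set V) from hb) (by simp [hAe])
  obtain ⟨u, hu, hu1, hpos⟩ : ∃ u ∈ A.directionᗮ, ‖u‖ = 1 ∧ 0 ≤ inner ℝ (p - b₀) u := by
    have hn : ‖‖v‖⁻¹ • v‖ = 1 := by
      rw [norm_smul, norm_inv, norm_norm, inv_mul_cancel₀ (norm_ne_zero_iff.2 hv0)]
    have hmem : ‖v‖⁻¹ • v ∈ A.directionᗮ := Submodule.smul_mem _ _ hv
    rcases le_total 0 (inner ℝ (p - b₀) (‖v‖⁻¹ • v)) with h | h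
    · exact ⟨_, hmem, hn, h⟩
    · refine ⟨-(‖v‖⁻¹ • v), Submodule.neg_mem _ hmem, by rw [norm_neg, hn], ?_⟩
      rw [inner_neg_right]
      linarith
  refine ⟨p + t • u, ?_, fun b hb => ?_⟩
  · rw [dist_self_add_left, norm_smul, hu1, mul_one, Real.norm_eq_abs, abs_of_nonneg ht]
  · have h2 : inner ℝ (b₀ - b) u = 0 :=
      Submodule.inner_right_of_mem_orthogonal (AffineSubspace.vsub_mem_direction hb₀ hb) hu
    have h3 : inner ℝ (p + t • u - b) u = inner ℝ (p - b₀) u + t := by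
      rw [show p + t • u - b = (p - b₀) + (b₀ - b) + t • u by abel, inner_add_left, inner_add_left,
        h2, real_inner_smul_left, real_inner_self_eq_norm_sq, hu1]
      ring
    have h4 := real_inner_le_norm (p + t • u - b) u
    rw [h3, hu1, mul_one, ← dist_eq_norm] at h4
    linarith

variable {Γ μ e ξ : ℝ} {k : ℕ} {τ : Finset (E m)} {g : E m → E m}

/-- The facets of a nearly cospherical simplex are good, so they do not degenerate under a change of
coordinates of small distortion: a dependency among the images would be, by `norm_sum_smul_sq`, a
short vector of the original affine hull with a large coefficient. -/
theorem IsNearlyCospherical.affinelyFree (hΓ : 0 < Γ) (hμ : 0 < μ) (hμ1 : μ ≤ 1) (he : 0 < e)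
    (hΓμ : Γ ≤ μ / 2 ^ 20) (hkm : k ≤ m) (hξ : 0 ≤ ξ) (hξΓ : ξ ≤ 1 / 2 ^ 4 * Γ ^ (4 * m + 2))
    {a b : ℝ}
    (h : IsNearlyCospherical Γ (μ * e / 2) ((5 / 2 + μ / 8) * e) a b k τ)
    (hg : ∀ x ∈ τ, ∀ y ∈ τ, |dist x y - dist (g x) (g y)| ≤ ξ * dist x y) {q : E m} (hq : q ∈ τ) :
    AffinelyFree (oppFacet τ q) g := by
  have hΓ1 : Γ ≤ 1 := by linarith
  have hξ1 : ξ ≤ 1 := hξΓ.trans (by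
    have := pow_le_one₀ (n := 4 * m + 2) hΓ.le hΓ1
    linarith)
  have hcq := card_oppFacet hq (h.card_eq : τ.card = (k + 1) + 1)
  have hkn := h.one_le
  have hk1 : (1 : ℝ) ≤ k := by exact_mod_cast hkn
  have hsub : ∀ {v}, v ∈ oppFacet τ q → v ∈ τ := fun hv => (mem_oppFacet.1 hv).2
  intro w hw hsum
  obtain ⟨v₀, hv₀, hmax⟩ := Finset.exists_max_image (oppFacet τ q) (fun v => |w v|)
    (Finset.card_pos.1 (by omega))
  suffices h0 : |w v₀| = 0 by
    intro v hv
    exact abs_nonpos_iff.1 (h0 ▸ hmax v hv)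
  by_contra hne
  have hW : 0 < |w v₀| := lt_of_le_of_ne (abs_nonneg _) (Ne.symm hne)
  have hsumW : ∑ v ∈ oppFacet τ q, |w v| ≤ 2 * k * |w v₀| := by
    refine (Finset.sum_le_card_nsmul _ _ _ hmax).trans ?_
    rw [hcq, nsmul_eq_mul]
    push_cast
    gcongr
    linarith
  have hdiff := abs_inertia_sub_le (f := id) (g := g) (s := oppFacet τ q) w
    (η := 3 * ξ * (3 * e) ^ 2) fun v hv u hu => by
      refine abs_sq_sub_sq_le dist_nonneg dist_nonneg hξ hξ1 ?_ (hg v (hsub hv) u (hsub hu))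
      exact (h.dist_le v (hsub hv) u (hsub hu)).trans (by gcongr; linarith)
  have h1 := norm_sum_smul_sq hw g
  rw [hsum, norm_zero] at h1
  have h2 := norm_sum_smul_sq hw id
  simp only [id] at h2
  have h3 := abs_mul_altitude_le hw hv₀
  have h4 : Γ ^ k * (k * (μ * e / 2)) ≤ altitude (oppFacet τ q) v₀ := by
    refine le_trans ?_ ((h.isGood q hq).le_altitude hcq h.one_le hv₀)
    gcongr
    exact le_diam_of_separated (by omega) fun a ha b hb => h.le_dist a (hsub ha) b (hsub hb)
  have h5 : (|w v₀| * (Γ ^ k * (k * (μ * e / 2)))) ^ 2 ≤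
      1 / 2 * (2 * k * |w v₀|) ^ 2 * (3 * ξ * (3 * e) ^ 2) := by
    calc (|w v₀| * (Γ ^ k * (k * (μ * e / 2)))) ^ 2
        ≤ ‖∑ v ∈ oppFacet τ q, w v • v‖ ^ 2 := by
          gcongr
          exact (mul_le_mul_of_nonneg_left h4 (abs_nonneg _)).trans h3
      _ ≤ 1 / 2 * (∑ v ∈ oppFacet τ q, |w v|) ^ 2 * (3 * ξ * (3 * e) ^ 2) := by
          have := (abs_le.1 hdiff).1
          have h0 : inertia (oppFacet τ q) w g = 0 := by linarith
          rw [h2]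
          change - inertia (oppFacet τ q) w id ≤ _
          linarith
      _ ≤ _ := by
          have : 0 ≤ ∑ v ∈ oppFacet τ q, |w v| := Finset.sum_nonneg fun _ _ => abs_nonneg _
          gcongr
  have h6 : ξ ≤ 1 / 2 ^ 4 * (Γ ^ (2 * k) * Γ ^ 2) := by
    refine hξΓ.trans ?_
    rw [← pow_add]
    gcongr ?_ * ?_
    exact pow_le_pow_of_le_one hΓ.le hΓ1 (by omega)
  have h7 : (|w v₀| * (Γ ^ k * (k * (μ * e / 2)))) ^ 2 ≤
      1 / 2 * (2 * k * |w v₀|) ^ 2 * (3 * (1 / 2 ^ 4 * (Γ ^ (2 * k) * Γ ^ 2)) * (3 * e) ^ 2) :=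
    h5.trans (by gcongr)
  have hP : 0 < |w v₀| ^ 2 * k ^ 2 * e ^ 2 * Γ ^ (2 * k) := by positivity
  have h8 : (|w v₀| ^ 2 * k ^ 2 * e ^ 2 * Γ ^ (2 * k)) * (μ ^ 2 / 4) ≤
      (|w v₀| ^ 2 * k ^ 2 * e ^ 2 * Γ ^ (2 * k)) * (27 / 8 * Γ ^ 2) := by
    calc _ = (|w v₀| * (Γ ^ k * (k * (μ * e / 2)))) ^ 2 := by rw [mul_comm 2 k, pow_mul]; ring
      _ ≤ _ := h7
      _ = _ := by ring
  have h9 := le_of_mul_le_mul_left h8 hP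
  have h10 : Γ ^ 2 ≤ (μ / 2 ^ 20) ^ 2 := by gcongr
  have h11 : 0 < μ ^ 2 := by positivity
  rw [div_pow] at h10
  linarith

/-- After a change of coordinates of small distortion, each vertex of a nearly cospherical simplex
is close to every sphere through the vertices of the opposite facet. -/
theorem IsNearlyCospherical.abs_dist_sub_radius_le (hΓ : 0 < Γ) (hμ : 0 < μ) (hμ1 : μ ≤ 1) (he : 0
    < e)
    (hΓμ : Γ ≤ μ ^ 4 / 2 ^ 20) (hkm : k ≤ m) (hξ : 0 ≤ ξ)
    (hξΓ : ξ ≤ 1 / 2 ^ 4 * Γ ^ (4 * m + 2))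
    (h : IsNearlyCospherical Γ (μ * e / 2) ((5 / 2 + μ / 8) * e) (2 ^ 14 * Γ / μ ^ 3 * e)
      (2 ^ 8 * Γ / μ * e ^ 2) k τ)
    (hg : ∀ x ∈ τ, ∀ y ∈ τ, |dist x y - dist (g x) (g y)| ≤ ξ * dist x y) {q : E m} (hq : q ∈ τ)
    {c : E m} {R : ℝ} (hR : 0 ≤ R) (hc : ∀ v ∈ oppFacet τ q, dist (g v) c = R) :
    |dist (g q) c - R| ≤ 2 ^ 15 * Γ / μ ^ 3 * e := by
  have hΓμ' : Γ ≤ μ / 2 ^ 20 := hΓμ.trans (by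
    gcongr
    calc μ ^ 4 ≤ μ ^ 1 := pow_le_pow_of_le_one hμ.le hμ1 (by norm_num)
      _ = μ := pow_one μ)
  have hΓ1 : Γ ≤ 1 := by linarith
  have hξ4 : ξ ≤ 1 / 2 ^ 4 := hξΓ.trans (by
    have := pow_le_one₀ (n := 4 * m + 2) hΓ.le hΓ1
    linarith)
  have hξ1 : ξ ≤ 1 := by linarith
  have hcq := card_oppFacet hq (h.card_eq : τ.card = (k + 1) + 1)
  have hkn := h.one_le
  have hk1 : (1 : ℝ) ≤ k := by exact_mod_cast hkn
  have hsub : ∀ {v}, v ∈ oppFacet τ q → v ∈ τ := fun hv => (mem_oppFacet.1 hv).2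
  have hr : ∀ x ∈ τ, ∀ y ∈ τ, dist x y ≤ 3 * e := fun x hx y hy =>
    (h.dist_le x hx y hy).trans (by gcongr; linarith)
  have hη : ∀ x ∈ τ, ∀ y ∈ τ,
      |dist x y ^ 2 - dist (g x) (g y) ^ 2| ≤ 3 * ξ * (3 * e) ^ 2 := fun x hx y hy =>
    abs_sq_sub_sq_le dist_nonneg dist_nonneg hξ hξ1 (hr x hx y hy) (hg x hx y hy)
  obtain ⟨w, hw, hwd, hwi⟩ := h.exists_weights q hq
  set x := ∑ v ∈ oppFacet τ q, w v • v with hx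
  set y := ∑ v ∈ oppFacet τ q, w v • g v with hy
  set Λ := ∑ v ∈ oppFacet τ q, |w v| with hΛ
  have hΛ0 : 0 ≤ Λ := Finset.sum_nonneg fun _ _ => abs_nonneg _
  have ha : 2 ^ 14 * Γ / μ ^ 3 * e ≤ 1 / 4 * e := by
    refine mul_le_mul_of_nonneg_right ?_ he.le
    rw [div_le_iff₀ (by positivity)]
    have h1 : μ ^ 4 ≤ μ ^ 3 := pow_le_pow_of_le_one hμ.le hμ1 (by norm_num)
    have : 0 < μ ^ 3 := by positivity
    linarith
  have hΛle : Λ * (Γ ^ k * μ) ≤ 12 := by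
    have h1 : ∀ v ∈ oppFacet τ q, |w v| * (Γ ^ k * (k * (μ * e / 2))) ≤ 3 * e := by
      intro v hv
      refine (h.isGood q hq).abs_weight_mul_le hΓ.le hcq h.one_le
        (le_diam_of_separated (by omega) fun a ha b hb => h.le_dist a (hsub ha) b (hsub hb))
        hw (fun u hu => ?_) hv
      refine (dist_triangle_left _ _ q).trans ?_
      have := h.dist_le q hq u (hsub hu)
      nlinarith
    have h2 : Λ * (Γ ^ k * (k * (μ * e / 2))) ≤ 2 * k * (3 * e) := by
      rw [hΛ, Finset.sum_mul]
      refine (Finset.sum_le_card_nsmul _ _ _ h1).trans ?_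
      rw [hcq, nsmul_eq_mul]
      push_cast
      gcongr
      linarith
    have h3 : (Λ * (Γ ^ k * μ)) * (k * e / 2) ≤ 12 * (k * e / 2) := by
      calc _ = Λ * (Γ ^ k * (k * (μ * e / 2))) := by ring
        _ ≤ _ := h2
        _ = _ := by ring
    exact le_of_mul_le_mul_right h3 (by positivity)
  -- The bound `12 / (Γ ^ k * μ)` for the sum of the weights is compensated by the factor
  -- `Γ ^ (4 * m + 2)` in the bound for `ξ`, since `k ≤ m`.
  have hΛη : Λ ^ 2 * (3 * ξ * (3 * e) ^ 2) ≤ 243 * (Γ / μ * e) ^ 2 := by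
    have h1 : ξ ≤ 1 / 2 ^ 4 * (Γ ^ (2 * k) * Γ ^ 2) := by
      refine hξΓ.trans ?_
      rw [← pow_add]
      gcongr ?_ * ?_
      exact pow_le_pow_of_le_one hΓ.le hΓ1 (by omega)
    calc Λ ^ 2 * (3 * ξ * (3 * e) ^ 2)
        ≤ Λ ^ 2 * (3 * (1 / 2 ^ 4 * (Γ ^ (2 * k) * Γ ^ 2)) * (3 * e) ^ 2) := by gcongr
      _ = (Λ * (Γ ^ k * μ)) ^ 2 * (27 / 16 * (Γ / μ * e) ^ 2) := by
          field_simp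
          rw [mul_comm 2 k, pow_mul]
          ring
      _ ≤ 12 ^ 2 * (27 / 16 * (Γ / μ * e) ^ 2) := by gcongr
      _ = _ := by ring
  have hG : Γ / μ * e ≤ Γ / μ ^ 3 * e := by
    gcongr ?_ * _
    gcongr _ / ?_
    calc μ ^ 3 ≤ μ ^ 1 := pow_le_pow_of_le_one hμ.le hμ1 (by norm_num)
      _ = μ := pow_one μ
  have hG0 : 0 < Γ / μ * e := by positivity
  -- the distance of the vertex to the affine combination of the other vertices
  have hyd : dist y (g q) ≤ 2 ^ 14 * Γ / μ ^ 3 * e + 20 * (Γ / μ * e) := by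
    have h1 := dist_sum_smul_sq_le hw (f := id) (g := g) (x := q) (y := g q)
      (η := 3 * ξ * (3 * e) ^ 2) (by positivity) (fun v hv => hη v (hsub hv) q hq)
      (fun v hv u hu => hη v (hsub hv) u (hsub hu))
    have h2 : dist x q ≤ 2 ^ 14 * Γ / μ ^ 3 * e := by rwa [dist_comm]
    have h3 : dist y (g q) ^ 2 ≤ dist x q ^ 2 + 3 / 2 * Λ ^ 2 * (3 * ξ * (3 * e) ^ 2) := h1
    have h4 : dist x q ^ 2 ≤ (2 ^ 14 * Γ / μ ^ 3 * e) ^ 2 := by gcongr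
    refine le_of_sq_le_sq ?_ (by positivity)
    have h5 : 0 ≤ 2 ^ 14 * Γ / μ ^ 3 * e := by positivity
    nlinarith [mul_nonneg h5 hG0.le, sq_nonneg (Γ / μ * e)]
  -- the power of that affine combination
  have hpow : |dist y c ^ 2 - R ^ 2| ≤ 2 ^ 9 * (Γ / μ * e ^ 2) := by
    have h1 := dist_sum_smul_sq_of_dist_eq hw hc
    have h2 := abs_inertia_sub_le (f := id) (g := g) (s := oppFacet τ q) w
      (η := 3 * ξ * (3 * e) ^ 2) (fun v hv u hu => hη v (hsub hv) u (hsub hu))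
    have h3 : (Γ / μ * e) ^ 2 ≤ Γ / μ * e ^ 2 := by
      have h4 : Γ / μ ≤ 1 := by
        rw [div_le_one hμ]
        linarith
      calc (Γ / μ * e) ^ 2 = Γ / μ * (Γ / μ * e ^ 2) := by ring
        _ ≤ 1 * (Γ / μ * e ^ 2) := by gcongr
        _ = _ := one_mul _
    rw [h1]
    have h5 : 2 ^ 8 * Γ / μ * e ^ 2 = 2 ^ 8 * (Γ / μ * e ^ 2) := by ring
    rw [h5] at hwi
    rw [abs_le] at h2 hwi ⊢
    constructor <;> linarith [h2.1, h2.2, hwi.1, hwi.2]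
  have hRlow : μ * e / 8 ≤ R := by
    obtain ⟨u, hu, v, hv, huv⟩ := Finset.one_lt_card.1 (by omega : 1 < (oppFacet τ q).card)
    have h1 := h.le_dist u (hsub hu) v (hsub hv) huv
    have h2 := (abs_le.1 (hg u (hsub hu) v (hsub hv))).2
    have h3 := dist_triangle_right (g u) (g v) c
    rw [hc u hu, hc v hv] at h3
    nlinarith [mul_pos hμ he]
  have hyc : |dist y c - R| ≤ 2 ^ 12 * Γ / μ ^ 2 * e := by
    have h1 : |dist y c - R| * (μ * e / 8) ≤ 2 ^ 9 * (Γ / μ * e ^ 2) := by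
      calc |dist y c - R| * (μ * e / 8) ≤ |dist y c - R| * |dist y c + R| := by
            gcongr
            exact (hRlow.trans (le_add_of_nonneg_left dist_nonneg)).trans (le_abs_self _)
        _ = |dist y c ^ 2 - R ^ 2| := by rw [← abs_mul]; congr 1; ring
        _ ≤ _ := hpow
    refine le_of_mul_le_mul_right (h1.trans (le_of_eq ?_)) (by positivity : 0 < μ * e / 8)
    field_simp
    norm_num
  have hG2 : Γ / μ ^ 2 * e ≤ Γ / μ ^ 3 * e := by
    gcongr ?_ * _
    gcongr _ / ?_
    exact pow_le_pow_of_le_one hμ.le hμ1 (by norm_num)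
  have h1 := abs_le.1 (abs_dist_sub_le (g q) y c)
  have h2 := abs_le.1 hyc
  rw [dist_comm (g q) y] at h1
  have h3 : 2 ^ 12 * Γ / μ ^ 2 * e = 2 ^ 12 * (Γ / μ ^ 2 * e) := by ring
  have h4 : 2 ^ 14 * Γ / μ ^ 3 * e = 2 ^ 14 * (Γ / μ ^ 3 * e) := by ring
  have h5 : 2 ^ 15 * Γ / μ ^ 3 * e = 2 ^ 15 * (Γ / μ ^ 3 * e) := by ring
  rw [h5]
  have h6 : 0 < Γ / μ ^ 3 * e := by positivity
  rw [abs_le]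
  constructor <;> linarith [h1.1, h1.2, h2.1, h2.2]

end Distortion

/-! ### Absence of nearly cospherical simplices in the output -/

namespace Input

variable {m n : ℕ} {M : Type*} [TopologicalSpace M] {D : Input m n M} {μ₀ ε₀ ξ₀ ρ₀ : ℝ}

theorem isPerturbation_pt (D : Input m n M) (hρ : 0 ≤ ρ₀) : D.IsPerturbation ρ₀ D.pt := fun l =>
  ⟨D.pt_mem l, by
    change dist (D.centre l) (D.centre l) ≤ _
    rw [dist_self]
    exact mul_nonneg hρ (D.radius_pos l).le⟩

theorem InputAssumptions.mem_target (hinput : D.InputAssumptions μ₀ ε₀ ξ₀) (hρ : ρ₀ < 8)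
    {l : Fin n} {x : E m} (hx : x ∈ closedBall (D.centre l) (ρ₀ * D.radius l)) :
    x ∈ (D.chart l).target :=
  hinput.ball_subset l (closedBall_subset_ball
    (mul_lt_mul_of_pos_right hρ (D.radius_pos l)) hx)

theorem InputAssumptions.isPerturbation (hinput : D.InputAssumptions μ₀ ε₀ ξ₀) (hρ : ρ₀ < 8)
    {q : Fin n → M} (hq : ∀ l, D.IsProcessed μ₀ ρ₀ q l) : D.IsPerturbation ρ₀ q := by
  intro l
  obtain ⟨x, hx, hqx, -⟩ := hq l
  have hxt := hinput.mem_target hρ hx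
  rw [hqx, (D.chart l).right_inv hxt]
  exact ⟨(D.chart l).map_target hxt, hx⟩

theorem IsPerturbation.stage (hρ : 0 ≤ ρ₀) {q : Fin n → M} (hq : D.IsPerturbation ρ₀ q)
    (i : Fin n) : D.IsPerturbation ρ₀ (D.stage q i) := by
  intro l
  by_cases hl : l < i
  · simpa [Input.stage, hl] using hq l
  · simpa [Input.stage, hl] using D.isPerturbation_pt hρ l

/-- The labels of the vertices of the simplices that are avoided when the label `j` is
processed. -/
def nearLabels (D : Input m n M) (μ₀ : ℝ) (j : Fin n) : Set (Fin n) :=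
  {l | l ≠ j ∧ l ∈ D.nbrs j ∧
    D.coord j l ∈ ball (D.centre j) ((5 + 3 * μ₀ / 2) * D.radius j)}

section

variable [T2Space M] (hinput : D.InputAssumptions μ₀ ε₀ ξ₀)
  (hparam : ParameterConstraints m μ₀ ε₀ ξ₀ ρ₀)

include hinput hparam

/-- An affinely independent family of at most `m` points can be enlarged by a point near
`D.centre j`, since the sample points are too dense to lie close to a hyperplane. -/
theorem exists_mem_nearLabels_notMem_affineSpan {q : Fin n → M} (hq : D.IsPerturbation ρ₀ q)
    (j : Fin n) {T : Finset (Fin n)} (hT : T.Nonempty) (hTm : T.card ≤ m) :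
    ∃ l ∈ D.nearLabels μ₀ j,
      D.chart j (q l) ∉ affineSpan ℝ ((fun l => D.chart j (q l)) '' T) := by
  classical
  have hf := D.radius_pos j
  set A := affineSpan ℝ ((fun l => D.chart j (q l)) '' T) with hA
  have hdir : A.direction ≠ ⊤ := by
    intro htop
    obtain ⟨d, hd⟩ := Nat.exists_eq_succ_of_ne_zero (Finset.card_pos.2 hT).ne'
    have h1 := finrank_vectorSpan_image_finset_le ℝ (fun l => D.chart j (q l)) T hd
    rw [Finset.coe_image, ← direction_affineSpan, ← hA, htop, finrank_top,
      finrank_euclideanSpace_fin] at h1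
    omega
  obtain ⟨y, hy, hyA⟩ := exists_dist_eq_forall_le_dist hdir (D.centre j)
    (by positivity : 0 ≤ 2 * D.radius j)
  obtain ⟨_, ⟨l, hl, rfl⟩, hyl⟩ := (hinput.net j).dense y (mem_ball.2 (by linarith))
  have h1 := dist_triangle_left (D.coord j l) (D.centre j) y
  have h2 := dist_triangle_right y (D.centre j) (D.coord j l)
  obtain ⟨hmem, hd⟩ := hq.mem_source hinput hparam hl (by linarith)
  have hμ := hparam.mu_pos
  have hμ1 := hparam.mu_le_one
  have hρ : tildeRho ε₀ ξ₀ ρ₀ * D.radius j ≤ 1 / 4 * D.radius j := by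
    gcongr
    linarith [hparam.rho_le]
  refine ⟨l, ⟨?_, hl, ?_⟩, fun hlA => ?_⟩
  · rintro rfl
    have : dist (D.centre l) (D.coord l l) = 0 := dist_self _
    linarith
  · rw [mem_ball]
    nlinarith
  · have h3 := hyA _ hlA
    have h4 := dist_triangle_right y (D.chart j (q l)) (D.coord j l)
    linarith

/-- An affinely independent set of near labels can be completed to an `m`-simplex that has to be
avoided when `j` is processed and that is not degenerate in its current position. -/
theorem exists_nearSimplices_affinelyFree {q : Fin n → M} (hq : D.IsPerturbation ρ₀ q)
    (j : Fin n) (d : ℕ) : ∀ T : Finset (Fin n), T.Nonempty → T.card + d = m + 1 →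
      (∀ l ∈ T, l ∈ D.nearLabels μ₀ j) → AffinelyFree T (fun l => D.chart j (q l)) →
      ∃ s ∈ D.nearSimplices μ₀ j, T ⊆ s ∧ AffinelyFree s (fun l => D.chart j (q l)) := by
  classical
  induction d with
  | zero => exact fun T _ hTm hnear hfree => ⟨T, ⟨hTm, hnear⟩, subset_rfl, hfree⟩
  | succ d ih =>
    intro T hT hTm hnear hfree
    obtain ⟨l, hl, hlA⟩ := exists_mem_nearLabels_notMem_affineSpan hinput hparam hq j hT (by omega)
    have hlT : l ∉ T := fun h => hlA (subset_affineSpan ℝ _ ⟨l, h, rfl⟩)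
    obtain ⟨s, hs, hTs, hfs⟩ := ih (insert l T) (Finset.insert_nonempty _ _)
      (by rw [Finset.card_insert_of_notMem hlT]; omega)
      (fun k hk => by
        rcases Finset.mem_insert.1 hk with rfl | hk
        · exact hl
        · exact hnear k hk)
      (hfree.insert hlT hlA)
    exact ⟨s, hs, (Finset.subset_insert _ _).trans hTs, hfs⟩

/-- The perturbed points close to `q j` in the patch of `i` are the perturbed positions, in the
patch of `j`, of points that were initially near `D.centre j`. -/
theorem IsPerturbation.mem_source_and_mem_nbrs {q : Fin n → M} (hq : D.IsPerturbation ρ₀ q)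
    {i j l : Fin n} (hj : q j ∈ (D.chart i).source)
    (hjd : dist (D.chart i (q j)) (D.centre i) < 6 * D.radius i)
    (hl : q l ∈ (D.chart i).source)
    (hld : dist (D.chart i (q l)) (D.centre i) < 6 * D.radius i)
    (hjl : dist (D.chart i (q j)) (D.chart i (q l)) ≤ (5 / 2 + μ₀ / 8) * D.radius i) :
    q l ∈ (D.chart j).source ∧ l ∈ D.nbrs j ∧
      D.coord j l ∈ ball (D.centre j) ((5 + 3 * μ₀ / 2) * D.radius j) := by
  have hμ := hparam.mu_pos
  have hμ1 := hparam.mu_le_one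
  have he := D.radius_pos i
  have hf := D.radius_pos j
  have hξ := hparam.xi_nonneg
  have hρ : tildeRho ε₀ ξ₀ ρ₀ * D.radius j ≤ μ₀ / 4 * D.radius j := by
    gcongr
    exact hparam.rho_le
  obtain ⟨hjn, hjn'⟩ := hq.mem_nbrs hinput hparam hj hjd
  have hrad : D.radius i ≤ (1 + ε₀) * D.radius j := by
    refine (hinput.radius_le hparam.eps_nonneg hjn ?_).1
    have h1 := dist_triangle_left (D.coord i j) (D.centre i) (D.chart i (q j))
    have h2 : tildeRho ε₀ ξ₀ ρ₀ * D.radius i ≤ 1 / 4 * D.radius i := by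
      gcongr
      linarith [hparam.rho_le]
    linarith
  have hr : (1 + ξ₀) * dist (D.chart i (q j)) (D.chart i (q l)) ≤ (5 + μ₀ / 4) * D.radius j := by
    calc (1 + ξ₀) * dist (D.chart i (q j)) (D.chart i (q l))
        ≤ (1 + ξ₀) * ((5 / 2 + μ₀ / 8) * ((1 + ε₀) * D.radius j)) := by
          gcongr
          exact hjl.trans (by gcongr)
      _ = ((1 + ε₀) * (1 + ξ₀)) * ((5 / 2 + μ₀ / 8) * D.radius j) := by ring
      _ ≤ 2 * ((5 / 2 + μ₀ / 8) * D.radius j) := by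
          gcongr
          exact hparam.one_add_mul_one_add_le
      _ = _ := by ring
  obtain ⟨hqj, hqjd⟩ := hq j
  have hqjd' : dist (D.chart j (q j)) (D.centre j) ≤ μ₀ / 4 * D.radius j := by
    refine hqjd.trans ?_
    gcongr
    exact hparam.rho_le_tildeRho.trans hparam.rho_le
  have hlj : q l ∈ (D.chart j).source := by
    refine hinput.mem_source hξ hj hqj hl ?_ hr ?_
    · refine ((convex_ball (D.centre i) (8 * D.radius i)).segment_subset ?_ ?_).trans
        (hinput.ball_subset i) <;> rw [mem_ball] <;> linarith
    · refine (closedBall_subset_ball' ?_).trans (hinput.ball_subset j)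
      nlinarith
  have h1 := (hinput.dist_le hj hqj hl hlj).trans hr
  have h2 := dist_triangle_left (D.chart j (q l)) (D.centre j) (D.chart j (q j))
  obtain ⟨h3, h4⟩ := hq.mem_nbrs hinput hparam hlj (by nlinarith)
  refine ⟨hlj, h3, ?_⟩
  have h5 := dist_triangle_left (D.coord j l) (D.centre j) (D.chart j (q l))
  rw [mem_ball]
  nlinarith

/-- The output contains no nearly cospherical simplex: the vertex that was processed last would
have been put too close to the diametric sphere of an `m`-simplex containing all other vertices. -/
theorem not_isNearlyCospherical {q : Fin n → M} (hq : ∀ l, D.IsProcessed μ₀ ρ₀ q l) (i : Fin n)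
    {k : ℕ} (hkm : k ≤ m) {τ : Finset (E m)} (hτ : (τ : Set (E m)) ⊆ D.region q i) :
    ¬ IsNearlyCospherical (gammaZero m μ₀ ρ₀) (μ₀ * D.radius i / 2)
      ((5 / 2 + μ₀ / 8) * D.radius i) (2 ^ 14 * gammaZero m μ₀ ρ₀ / μ₀ ^ 3 * D.radius i)
      (2 ^ 8 * gammaZero m μ₀ ρ₀ / μ₀ * D.radius i ^ 2) k τ := by
  classical
  intro h
  have hm := hparam.dim_pos
  have hμ := hparam.mu_pos
  have hμ1 := hparam.mu_le_one
  have he := D.radius_pos i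
  have hξ := hparam.xi_nonneg
  have hΓ := hparam.gammaZero_pos
  have hΓμ := hparam.gammaZero_le
  have hξΓ : ξ₀ ≤ 1 / 2 ^ 4 * gammaZero m μ₀ ρ₀ ^ (4 * m + 2) := hparam.xi_le
  have hρ8 : ρ₀ < 8 := by linarith [hparam.rho_le_tildeRho, hparam.rho_le]
  have hpert := hinput.isPerturbation hρ8 hq
  have hlab : ∀ v ∈ τ, ∃ l, q l ∈ (D.chart i).source ∧ D.chart i (q l) = v := by
    intro v hv
    obtain ⟨⟨_, ⟨⟨l, rfl⟩, hl⟩, hlv⟩, -⟩ := hτ hv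
    exact ⟨l, hl, hlv⟩
  have : Nonempty (Fin n) := ⟨i⟩
  choose! lab hlab hlabv using hlab
  have hinj : ∀ x ∈ τ, ∀ y ∈ τ, lab x = lab y → x = y := fun x hx y hy hxy => by
    rw [← hlabv x hx, ← hlabv y hy, hxy]
  obtain ⟨v, hv, hmax⟩ := Finset.exists_max_image τ lab
    (Finset.card_pos.1 (by rw [h.card_eq]; omega))
  set j := lab v with hj
  have hf := D.radius_pos j
  -- The labels of the other vertices are smaller, so these vertices did not move after `j` had been
  -- processed.
  have hlt : ∀ x ∈ oppFacet τ v, lab x < j := fun x hx =>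
    lt_of_le_of_ne (hmax x (mem_oppFacet.1 hx).2)
      fun hxv => (mem_oppFacet.1 hx).1 (hinj x (mem_oppFacet.1 hx).2 v hv hxv)
  have hnear : ∀ x ∈ τ, q (lab x) ∈ (D.chart j).source ∧ lab x ∈ D.nbrs j ∧
      D.coord j (lab x) ∈ ball (D.centre j) ((5 + 3 * μ₀ / 2) * D.radius j) := by
    intro x hx
    refine hpert.mem_source_and_mem_nbrs hinput hparam (hlab v hv) ?_ (hlab x hx) ?_ ?_
    · rw [hlabv v hv]
      exact (hτ hv).2
    · rw [hlabv x hx]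
      exact (hτ hx).2
    · rw [hlabv v hv, hlabv x hx]
      exact h.dist_le v hv x hx
  let g : E m → E m := fun x => D.chart j (q (lab x))
  have hg : ∀ x ∈ τ, ∀ y ∈ τ, |dist x y - dist (g x) (g y)| ≤ ξ₀ * dist x y := by
    intro x hx y hy
    have h1 := hinput.abs_dist_sub_dist_le (hlab x hx) (hnear x hx).1 (hlab y hy) (hnear y hy).1
    rwa [hlabv x hx, hlabv y hy] at h1
  have hΓμ' : gammaZero m μ₀ ρ₀ ≤ μ₀ / 2 ^ 20 := hΓμ.trans (by
    gcongr
    calc μ₀ ^ 4 ≤ μ₀ ^ 1 := pow_le_pow_of_le_one hμ.le hμ1 (by norm_num)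
      _ = μ₀ := pow_one μ₀)
  have hfree := h.affinelyFree hΓ hμ hμ1 he hΓμ' hkm hξ hξΓ hg hv
  let p : Fin n → E m := fun l => D.chart j (D.stage q j l)
  have hpg : ∀ x ∈ oppFacet τ v, p (lab x) = g x := fun x hx => by
    simp only [p, g, stage, if_pos (hlt x hx)]
  have hinjOn : Set.InjOn lab (oppFacet τ v) := fun x hx y hy hxy =>
    hinj x (mem_oppFacet.1 hx).2 y (mem_oppFacet.1 hy).2 hxy
  have hTcard : ((oppFacet τ v).image lab).card = k + 1 := by
    rw [Finset.card_image_of_injOn hinjOn, card_oppFacet hv h.card_eq]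
  have hTfree : AffinelyFree ((oppFacet τ v).image lab) p := by
    intro w hw hsum l hl
    rw [Finset.sum_image hinjOn] at hw hsum
    obtain ⟨x, hx, rfl⟩ := Finset.mem_image.1 hl
    refine hfree (fun x => w (lab x)) hw ?_ x hx
    rw [← hsum]
    exact Finset.sum_congr rfl fun y hy => by rw [hpg y hy]
  obtain ⟨s, hs, hTs, hsfree⟩ := exists_nearSimplices_affinelyFree hinput hparam
    (hpert.stage hparam.rho_pos.le j) j (m - k) ((oppFacet τ v).image lab)
    (Finset.card_pos.1 (by omega)) (by omega) (fun l hl => by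
      obtain ⟨x, hx, rfl⟩ := Finset.mem_image.1 hl
      exact ⟨(hlt x hx).ne, (hnear x (mem_oppFacet.1 hx).2).2⟩) hTfree
  obtain ⟨c, R, hR, hcR⟩ := exists_isCircumcentre hm hsfree hs.1
  obtain ⟨x, hx, hqx, hgood⟩ := hq j
  have hgv : g v = x := by
    change D.chart j (q j) = x
    rw [hqx, (D.chart j).right_inv (hinput.mem_target hρ8 hx)]
  have hclose := h.abs_dist_sub_radius_le hΓ hμ hμ1 he hΓμ hkm hξ hξΓ hg hv hR fun y hy => by
    rw [← hpg y hy]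
    exact hcR.1 _ (Finset.mem_image_of_mem _ (hTs (Finset.mem_image_of_mem lab hy)))
  refine hgood ⟨s, hs, c, R, by convert hcR, ?_⟩
  have hrad : D.radius i ≤ 2 * D.radius j := by
    have hvi : dist (D.chart i (q j)) (D.centre i) < 6 * D.radius i := by
      rw [hlabv v hv]
      exact (hτ hv).2
    obtain ⟨h1, h2⟩ := hpert.mem_nbrs hinput hparam (hlab v hv) hvi
    have h3 : tildeRho ε₀ ξ₀ ρ₀ * D.radius i ≤ 1 / 4 * D.radius i := by
      gcongr
      linarith [hparam.rho_le]
    have h4 := dist_triangle_left (D.coord i j) (D.centre i) (D.chart i (q j))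
    refine (hinput.radius_le hparam.eps_nonneg h1 (by linarith)).1.trans ?_
    gcongr
    linarith [hparam.eps_le_one]
  calc infDist x (sphere c R) ≤ |dist (g v) c - R| := by
        rw [hgv]
        exact infDist_sphere_le hm x c hR
    _ ≤ 2 ^ 15 * gammaZero m μ₀ ρ₀ / μ₀ ^ 3 * D.radius i := hclose
    _ ≤ 2 ^ 15 * gammaZero m μ₀ ρ₀ / μ₀ ^ 3 * (2 * D.radius j) := by gcongr
    _ = 2 * (2 ^ 15 * 1 * gammaZero m μ₀ ρ₀ / μ₀ ^ 3) * D.radius j := by ring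
    _ ≤ 2 * tildeAlpha m μ₀ ρ₀ * D.radius j := by
        rw [tildeAlpha]
        gcongr
        · norm_num
        · norm_num
        · exact hparam.one_le_rpow

end

end Input

end ManifoldMesh

theorem mainTheorem4 {m n : ℕ} {M : Type*} [TopologicalSpace M] [T2Space M]
    (D : ManifoldMesh.Input m n M) (μ₀ ε₀ ξ₀ ρ₀ : ℝ)
    (hinput : D.InputAssumptions μ₀ ε₀ ξ₀)
    (hparam : ManifoldMesh.ParameterConstraints m μ₀ ε₀ ξ₀ ρ₀) :
    -- the algorithm terminates almost surely
    (∀ᵐ ω ∂ManifoldMesh.trialLaw m, ∃ t, D.TerminatedAt μ₀ ρ₀ ω t) ∧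
    -- and every terminated run has the announced output
    ∀ ω : ℕ → ManifoldMesh.E m, (∀ t, ω t ∈ Metric.closedBall 0 1) →
      ∀ t, D.TerminatedAt μ₀ ρ₀ ω t → ∀ i : Fin n,
        let ρt := ManifoldMesh.tildeRho ε₀ ξ₀ ρ₀
        let μ' := (μ₀ - 2 * ρt) / (1 + ρt)
        let ε' := (1 + ρt) * D.radius i
        let Γ₀ := ρ₀ / ManifoldMesh.paramC m μ₀
        let δ := Γ₀ ^ (m + 1) * μ' * ε'
        let Q' := D.region (D.output μ₀ ρ₀ ω t) i
        ManifoldMesh.IsNet μ' ε' Q'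
            (Metric.closedBall (D.centre i) (6 * D.radius i - ε')) ∧
          ∀ τ : Finset (ManifoldMesh.E m), (τ : Set (ManifoldMesh.E m)) ⊆ Q' →
            ¬ ManifoldMesh.IsForbidden Γ₀ δ ε' τ ∧
            ¬ ManifoldMesh.HasForbiddenProperties μ₀ (D.radius i) Γ₀ (Γ₀ ^ (m + 1)) τ := by
  refine ⟨D.ae_exists_terminatedAt hinput hparam, fun ω hω t ht i => ?_⟩
  intro ρt μ' ε' Γ₀ δ Q'
  have hμ := hparam.mu_pos
  have hμ1 := hparam.mu_le_one
  have he := D.radius_pos i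
  have hρ0 : 0 < ρt := hparam.tildeRho_pos
  have hρμ : ρt ≤ μ₀ / 4 := hparam.rho_le
  have hΓ : 0 < Γ₀ := hparam.gammaZero_pos
  have hΓμ : Γ₀ ≤ μ₀ ^ 4 / 2 ^ 20 := hparam.gammaZero_le
  have hproc := D.isProcessed_output hparam.rho_pos.le hω ht
  have hpert := hinput.isPerturbation
    (by linarith [hparam.rho_le_tildeRho, hparam.rho_le] : ρ₀ < 8) hproc
  refine ⟨hpert.isNet hinput hparam i, fun τ hτ => ?_⟩
  have hsep : ∀ x ∈ τ, ∀ y ∈ τ, x ≠ y → μ₀ * D.radius i / 2 ≤ dist x y := by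
    intro x hx y hy hxy
    refine le_trans ?_ (hpert.le_dist hinput hparam x (hτ hx) y (hτ hy) hxy)
    change _ ≤ (μ₀ - 2 * ρt) * D.radius i
    nlinarith
  constructor
  · intro h
    have hδ : δ ≤ Γ₀ ^ (m + 1) * μ₀ * D.radius i := by
      calc δ = Γ₀ ^ (m + 1) * (μ₀ - 2 * ρt) * D.radius i := by
            simp only [δ, μ', ε']
            have : 1 + ρt ≠ 0 := by linarith
            field_simp
        _ ≤ _ := by
            gcongr
            linarith
    have hε' : ε' ≤ 5 / 4 * D.radius i := by
      simp only [ε']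
      gcongr
      linarith
    obtain ⟨k, hkm, hk⟩ := h.exists_isNearlyCospherical hΓ hμ hμ1 he hΓμ hδ hε' hsep
    exact ManifoldMesh.Input.not_isNearlyCospherical hinput hparam hproc i hkm hτ hk
  · intro h
    have hδ₀ : Γ₀ ^ (m + 1) ≤ 1 / 10 := by
      have h1 : μ₀ ^ 4 ≤ 1 := pow_le_one₀ hμ.le hμ1
      have h2 : Γ₀ ≤ 1 / 10 := by linarith
      exact (pow_le_of_le_one hΓ.le (by linarith) (by omega)).trans h2
    obtain ⟨k, hkm, hk⟩ := h.exists_isNearlyCospherical hΓ hμ he hΓμ hδ₀ hsep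
    exact ManifoldMesh.Input.not_isNearlyCospherical hinput hparam hproc i hkm hτ hk
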